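/- Let $K$ be a field, let $n,d,t\ge 1$ be integers with $t\le n$ and $n\ge 1+(d-1)t$, and let $S=K[x_1,\dots,x_n]$ with the standard grading. A monomial $x_{i_1}x_{i_2}\cdots x_{i_e}$ with $i_1\le i_2\le\dots\le i_e$ is called $t$-spread if $i_{k+1}-i_k\ge t$ for all $k=1,\dots,e-1$, and a $t$-spread ideal is an ideal of $S$ generated by $t$-spread monomials. For a graded ideal $I$ of $S$ with minimal graded free resolution $\cdots\to F_1\to F_0\to I\to 0$, $F_i=\bigoplus_j S(-j)^{\beta_{i,j}(I)}$, let $\operatorname{reg}(I)=\max\{j-i:\beta_{i,j}(I)\neq 0\}$ be its Castelnuovo–Mumford regularity (with $\operatorname{reg}(0)=-\infty$). Put $m=\max\{\lceil n/d\rceil,\,t\}$. (1) If $I$ is a $t$-spread ideal of $S$ generated in degrees at most $d$, then $$\operatorname{reg}(I)\ \le\ n+1-\max\Big\{\Big\lceil\frac nd\Big\rceil,\,t\Big\}.$$ (2) The bound is attained: $m\le n$, and the Pascal ideal of type $(n,m)$, that is, the ideal $J$ generated by the monomials $$\prod_{\substack{1\le j\le n\\ j\equiv i\ (\mathrm{mod}\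 m)}}x_j,\qquad i=1,\dots,m,$$ which have pairwise disjoint supports, is a $t$-spread ideal generated in degrees at most $d$ with $\operatorname{reg}(J)=n+1-m$. -/

import Mathlib

open MvPolynomial

noncomputable section

namespace TSpread

variable {K : Type*} [Field K] {n : ℕ}

/-- The polynomial `u` is a `t`-spread monomial `x_{i_1} x_{i_2} ⋯ x_{i_e}`: consecutive indices in
the list `[i_1, …, i_e]` satisfy `i_{k+1} - i_k ≥ t`. The empty list gives `u = 1`.
The variables `x_1, …, x_n` are `X 0, …, X (n - 1)`. -/
def IsTSpreadMonomial (t : ℕ) (u : MvPolynomial (Fin n) K) : Prop :=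
  ∃ l : List (Fin n), l.IsChain (fun a b => (a : ℕ) + t ≤ (b : ℕ)) ∧ u = (l.map X).prod

/-- A `t`-spread ideal: an ideal generated by `t`-spread monomials. -/
def IsTSpreadIdeal (t : ℕ) (I : Ideal (MvPolynomial (Fin n) K)) : Prop :=
  ∃ A : Set (MvPolynomial (Fin n) K), (∀ u ∈ A, IsTSpreadMonomial t u) ∧ I = Ideal.span A

/-- `I` is generated by homogeneous elements of degrees at most `d`. -/
def IsGeneratedInDegreesLE (d : ℕ) (I : Ideal (MvPolynomial (Fin n) K)) : Prop :=
  ∃ A : Set (MvPolynomial (Fin n) K),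
    (∀ f ∈ A, ∃ e ≤ d, f.IsHomogeneous e) ∧ I = Ideal.span A

variable (K n) in
/-- The graded maximal ideal `(x_1, …, x_n)`. -/
def irrelevant : Ideal (MvPolynomial (Fin n) K) :=
  Ideal.span (Set.range X)

/-- A minimal graded free resolution `⋯ → F_2 → F_1 → F_0 → I → 0` of an ideal `I` of
`S = K[x_1, …, x_n]`, with `F_i = ⨁_k S(-shift i k)`, a finite direct sum.
(Minimality forces all the shifts to be nonnegative, as `I` lives in nonnegative degrees.) -/
structure MinimalGradedFreeResolution (I : Ideal (MvPolynomial (Fin n) K)) where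
  /-- the rank of `F_i` -/
  rank : ℕ → ℕ
  /-- the degrees of the basis elements of `F_i` -/
  shift : (i : ℕ) → Fin (rank i) → ℕ
  /-- the differential `F_{i+1} → F_i` -/
  d : (i : ℕ) →
    (Fin (rank (i + 1)) → MvPolynomial (Fin n) K) →ₗ[MvPolynomial (Fin n) K]
      (Fin (rank i) → MvPolynomial (Fin n) K)
  /-- the augmentation `F_0 → I ⊆ S` -/
  ε : (Fin (rank 0) → MvPolynomial (Fin n) K) →ₗ[MvPolynomial (Fin n) K] MvPolynomial (Fin n) K
  /-- the differentials preserve degrees: the `(k, l)` entry of the matrix of `d i` is zero or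
  homogeneous of degree `shift (i + 1) l - shift i k` -/
  d_homogeneous : ∀ i k l, ∀ m ∈ (d i (Pi.single l 1) k).support,
    m.degree + shift i k = shift (i + 1) l
  /-- the augmentation preserves degrees -/
  ε_homogeneous : ∀ k, (ε (Pi.single k 1)).IsHomogeneous (shift 0 k)
  /-- exactness at `I` -/
  range_ε : LinearMap.range ε = I
  /-- exactness at `F_0` -/
  exact_zero : Function.Exact (d 0) ε
  /-- exactness at `F_{i+1}` -/
  exact_succ : ∀ i, Function.Exact (d (i + 1)) (d i)
  /-- minimality: the image of `F_{i+1}` is contained in `𝔪 F_i` -/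
  minimal : ∀ i, LinearMap.range (d i) ≤
    irrelevant K n • (⊤ : Submodule (MvPolynomial (Fin n) K) (Fin (rank i) → MvPolynomial (Fin n) K))

/-- The number of direct summands `S(-j)` of `F_i`. -/
def MinimalGradedFreeResolution.betti {I : Ideal (MvPolynomial (Fin n) K)}
    (F : MinimalGradedFreeResolution I) (i j : ℕ) : ℕ :=
  Fintype.card {k : Fin (F.rank i) // F.shift i k = j}

open Classical in
/-- The graded Betti number `β_{i,j}(I)` of a graded ideal `I`: the number of summands `S(-j)` of
`F_i` in the minimal graded free resolution of `I`, which exists and is unique up to isomorphism.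
(The value `0` in the second case is only taken at ideals that are not graded.) -/
def gradedBetti (I : Ideal (MvPolynomial (Fin n) K)) (i j : ℕ) : ℕ :=
  if h : Nonempty (MinimalGradedFreeResolution I) then h.some.betti i j else 0

/-- The Castelnuovo–Mumford regularity `reg(I) = max {j - i : β_{i,j}(I) ≠ 0}`, as an extended
integer. It is `-∞` for the zero ideal. -/
def regularity (I : Ideal (MvPolynomial (Fin n) K)) : WithBot (WithTop ℤ) :=
  sSup {r | ∃ i j : ℕ, gradedBetti I i j ≠ 0 ∧ r = (((j : ℤ) - (i : ℤ) : ℤ) : WithTop ℤ)}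

variable (K n) in
/-- The monomial `∏ x_j` over all `1 ≤ j ≤ n` with `j ≡ i (mod m)`; here `x_j = X (j - 1)`. -/
def pascalMonomial (m i : ℕ) : MvPolynomial (Fin n) K :=
  ∏ j ∈ Finset.univ.filter (fun j : Fin n => (j : ℕ) + 1 ≡ i [MOD m]), X j

variable (K n) in
/-- The Pascal ideal of type `(n, m)`, generated by `pascalMonomial K n m i` for `1 ≤ i ≤ m`. -/
def pascalIdeal (m : ℕ) : Ideal (MvPolynomial (Fin n) K) :=
  Ideal.span (pascalMonomial K n m '' Set.Icc 1 m)

end TSpread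

end

/-! Everything is read off from the Koszul homology `H_i(S/I)` with respect to `x_1, …, x_n`,
indexed by the homological degree `i` and the coefficient degree `p`, so that the internal degree is
`i + p`. Dimension shifting along a minimal resolution shows that `β_{i,j}(I) ≠ 0` exactly when
`H_{i+1}(S/I)` is nonzero at `p = j - i - 1`, except possibly for `(i, j) = (0, 0)`. Hence `reg I ≤
r + 1` follows from vanishing for all `p > r` (`RegularityLE I r`), where `r = n - m`.

Upper bound. For `t ≥ 1` the ideal is a squarefree monomial ideal, encoded by a family `𝓕` of
subsets of the variables. The sequence `0 → S/(I : x_k)(-1) → S/I → S/(I, x_k) → 0` gives `reg S/I ≤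
max (reg S/(I : x_k) + 1) (reg S/(I, x_k))`, and both outer ideals involve one variable fewer. Two
inductions on the number `v` of remaining variables use it. If generators have degree at most `d`,
splitting along all variables of one generator gives `reg S/I ≤ v - ⌈v/d⌉`
(`regularityLE_of_degree_le`). If every generator meets a set `W` in at most one variable, splitting
along the variables outside `W` gives `reg S/I ≤ v - |W|` (`regularityLE_of_card_inter_le_one`); for
`t`-spread ideals `W = {x_1, …, x_t}` works. Together they give `n - m`.

Sharpness. The Pascal generators partition the variables into `m` disjoint supports, so they form a
regular sequence of total degree `n`. The top Koszul homology of the quotient sits in homological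
degree `m` and internal degree `n`, that is, at `p = n - m` (`disjoint_supports_regularity`). To
turn this into a statement on `regularity`, a minimal graded free resolution must also be shown to
exist. -/

noncomputable section

namespace TSpread


/-! ### Koszul homology of graded modules and its long exact sequence -/

section Koszul

variable {R : Type*} [CommRing R]

/-- The underlying module of the Koszul complex of `M` with respect to a list of ring elements,
built as an iterated mapping cone. -/
def KoszulModule (M : Type*) : List R → Type _
  | [] => M
  | _ :: l => KoszulModule M l × KoszulModule M l

instance koszulAddCommGroup (M : Type*) [AddCommGroup M] :
    (l : List R) → AddCommGroup (KoszulModule M l)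
  | [] => inferInstanceAs (AddCommGroup M)
  | _ :: l =>
    letI := koszulAddCommGroup M l
    inferInstanceAs (AddCommGroup (KoszulModule M l × KoszulModule M l))

instance koszulSMulModule (M : Type*) [AddCommGroup M] [Module R M] :
    (l : List R) → Module R (KoszulModule M l)
  | [] => inferInstanceAs (Module R M)
  | _ :: l =>
    letI := koszulSMulModule M l
    inferInstanceAs (Module R (KoszulModule M l × KoszulModule M l))

variable {M N A B C : Type*} [AddCommGroup M] [Module R M] [AddCommGroup N] [Module R N]
  [AddCommGroup A] [Module R A] [AddCommGroup B] [Module R B] [AddCommGroup C] [Module R C]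

/-- The differential of the Koszul complex. -/
def koszulD (M : Type*) [AddCommGroup M] [Module R M] :
    (l : List R) → KoszulModule M l →ₗ[R] KoszulModule M l
  | [] => 0
  | x :: l => LinearMap.prod
      (koszulD M l ∘ₗ LinearMap.fst R (KoszulModule M l) (KoszulModule M l) +
        x • LinearMap.snd R (KoszulModule M l) (KoszulModule M l))
      (-(koszulD M l ∘ₗ LinearMap.snd R (KoszulModule M l) (KoszulModule M l)))

/-- The map of Koszul complexes induced by a linear map. -/
def koszulMap (f : M →ₗ[R] N) : (l : List R) → KoszulModule M l →ₗ[R] KoszulModule N l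
  | [] => f
  | _ :: l => LinearMap.prodMap (koszulMap f l) (koszulMap f l)

/-- The part of homological degree `i` and total degree `i + p` of the Koszul complex of a module
with graded pieces `𝒜 p`. -/
def koszulPart (𝒜 : ℤ → AddSubgroup M) : (l : List R) → ℤ → ℤ → AddSubgroup (KoszulModule M l)
  | [], i, p => if i = 0 then 𝒜 p else ⊥
  | _ :: l, i, p => (koszulPart 𝒜 l i p).prod (koszulPart 𝒜 l (i - 1) p)

/-- The Koszul homology of `M` vanishes in homological degree `i` and total degree `i + p`. -/
def KoszulVanishes (𝒜 : ℤ → AddSubgroup M) (l : List R) (i p : ℤ) : Prop :=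
  ∀ c ∈ koszulPart 𝒜 l i p, koszulD M l c = 0 →
    ∃ b ∈ koszulPart 𝒜 l (i + 1) (p - 1), koszulD M l b = c

theorem koszulD_cons (x : R) (l : List R) (a b : KoszulModule M l) :
    koszulD M (x :: l) (a, b) = (koszulD M l a + x • b, -koszulD M l b) := rfl

theorem koszulMap_cons (f : M →ₗ[R] N) (x : R) (l : List R) (a b : KoszulModule M l) :
    koszulMap f (x :: l) (a, b) = (koszulMap f l a, koszulMap f l b) := rfl

omit [CommRing R] [Module R M] in
theorem mem_koszulPart_nil (𝒜 : ℤ → AddSubgroup M) (i p : ℤ) (a : M) :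
    a ∈ (koszulPart 𝒜 ([] : List R) i p : AddSubgroup M) ↔ (i = 0 ∧ a ∈ 𝒜 p) ∨ a = 0 := by
  unfold koszulPart
  split_ifs with h
  · simp only [h, true_and]
    exact ⟨Or.inl, fun h => h.elim id (fun h => h ▸ zero_mem _)⟩
  · simp only [h, false_and, false_or]
    exact AddSubgroup.mem_bot

theorem koszulD_koszulD (l : List R) (c : KoszulModule M l) : koszulD M l (koszulD M l c) = 0 := by
  induction l with
  | nil => rfl
  | cons x l ih =>
    obtain ⟨a, b⟩ := c
    rw [koszulD_cons, koszulD_cons]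
    refine Prod.ext ?_ ?_
    · change koszulD M l (koszulD M l a + x • b) + x • -koszulD M l b = 0
      rw [map_add, map_smul, ih]; simp
    · change -koszulD M l (-koszulD M l b) = 0
      rw [map_neg, ih]; simp

theorem koszulMap_koszulD (f : M →ₗ[R] N) (l : List R) (c : KoszulModule M l) :
    koszulMap f l (koszulD M l c) = koszulD N l (koszulMap f l c) := by
  induction l with
  | nil => exact map_zero f
  | cons x l ih =>
    obtain ⟨a, b⟩ := c
    rw [koszulD_cons, koszulMap_cons, koszulMap_cons, koszulD_cons]
    simp only [map_add, map_smul, map_neg, ih]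
    rfl

theorem smul_mem_koszulPart {𝒜 : ℤ → AddSubgroup M} {x : R}
    (hx : ∀ p, ∀ a ∈ 𝒜 p, x • a ∈ 𝒜 (p + 1)) (l : List R) (i p : ℤ) (c : KoszulModule M l)
    (hc : c ∈ koszulPart 𝒜 l i p) : x • c ∈ koszulPart 𝒜 l i (p + 1) := by
  induction l generalizing i p with
  | nil =>
    rcases (mem_koszulPart_nil 𝒜 i p c).1 hc with h | h
    · exact (mem_koszulPart_nil 𝒜 i (p + 1) _).2 (Or.inl ⟨h.1, hx p c h.2⟩)
    · rw [h]
      have : x • (0 : M) = 0 := smul_zero x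
      exact (mem_koszulPart_nil 𝒜 i (p + 1) _).2 (Or.inr this)
  | cons y l ih =>
    obtain ⟨a, b⟩ := c
    exact ⟨ih _ _ _ hc.1, ih _ _ _ hc.2⟩

/-- Multiplication by the elements of `l` raises degrees by one. -/
def RaisesDegree (𝒜 : ℤ → AddSubgroup M) (l : List R) : Prop :=
  ∀ x ∈ l, ∀ p, ∀ a ∈ 𝒜 p, x • a ∈ 𝒜 (p + 1)

theorem koszulD_mem {𝒜 : ℤ → AddSubgroup M} {l : List R} (hl : RaisesDegree 𝒜 l) (i p : ℤ)
    (c : KoszulModule M l) (hc : c ∈ koszulPart 𝒜 l i p) :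
    koszulD M l c ∈ koszulPart 𝒜 l (i - 1) (p + 1) := by
  induction l generalizing i p with
  | nil => exact zero_mem _
  | cons x l ih =>
    obtain ⟨a, b⟩ := c
    have hl' : RaisesDegree 𝒜 l := fun y hy => hl y (List.mem_cons_of_mem _ hy)
    rw [koszulD_cons]
    exact ⟨add_mem (ih hl' _ _ _ hc.1)
      (smul_mem_koszulPart (hl x List.mem_cons_self) _ _ _ _ hc.2),
      (koszulPart 𝒜 l _ _).neg_mem (ih hl' _ _ _ hc.2)⟩

omit [CommRing R] [Module R M] in
theorem koszulPart_of_neg (𝒜 : ℤ → AddSubgroup M) (l : List R) {i : ℤ} (hi : i < 0) (p : ℤ)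
    (c : KoszulModule M l) (hc : c ∈ koszulPart 𝒜 l i p) : c = 0 := by
  induction l generalizing i with
  | nil =>
    rcases (mem_koszulPart_nil 𝒜 i p c).1 hc with h | h
    · omega
    · exact h
  | cons x l ih =>
    obtain ⟨a, b⟩ := c
    exact Prod.ext (ih hi a hc.1) (ih (by omega) b hc.2)

omit [CommRing R] [Module R M] in
theorem koszulPart_of_eq_bot {𝒜 : ℤ → AddSubgroup M} {p : ℤ} (hp : 𝒜 p = ⊥) (l : List R) (i : ℤ)
    (c : KoszulModule M l) (hc : c ∈ koszulPart 𝒜 l i p) : c = 0 := by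
  induction l generalizing i with
  | nil =>
    rcases (mem_koszulPart_nil 𝒜 i p c).1 hc with h | h
    · have := h.2
      rw [hp] at this
      exact this
    · exact h
  | cons x l ih =>
    obtain ⟨a, b⟩ := c
    exact Prod.ext (ih i a hc.1) (ih _ b hc.2)

theorem koszulVanishes_of_eq_bot {𝒜 : ℤ → AddSubgroup M} {p : ℤ} (hp : 𝒜 p = ⊥) (l : List R)
    (i : ℤ) : KoszulVanishes 𝒜 l i p := fun c hc _ =>
  ⟨0, zero_mem _, by rw [koszulPart_of_eq_bot hp l i c hc, map_zero]⟩

omit [CommRing R] [Module R M] in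
theorem koszulPart_shift (𝒜 : ℤ → AddSubgroup M) (e : ℤ) (l : List R) (i p : ℤ) :
    koszulPart (fun q => 𝒜 (q - e)) l i p = koszulPart 𝒜 l i (p - e) := by
  induction l generalizing i with
  | nil => rfl
  | cons x l ih => simp only [koszulPart, ih]; rfl

theorem koszulVanishes_shift (𝒜 : ℤ → AddSubgroup M) (e : ℤ) (l : List R) (i p : ℤ) :
    KoszulVanishes (fun q => 𝒜 (q - e)) l i p ↔ KoszulVanishes 𝒜 l i (p - e) := by
  unfold KoszulVanishes
  rw [koszulPart_shift, koszulPart_shift, sub_right_comm]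

/-- A short exact sequence `0 → A → B → C → 0` of graded modules. -/
structure GradedShortExact (𝒜 : ℤ → AddSubgroup A) (ℬ : ℤ → AddSubgroup B)
    (𝒞 : ℤ → AddSubgroup C) (f : A →ₗ[R] B) (g : B →ₗ[R] C) : Prop where
  injective : ∀ a, f a = 0 → a = 0
  map_left : ∀ p, ∀ a ∈ 𝒜 p, f a ∈ ℬ p
  map_right : ∀ p, ∀ b ∈ ℬ p, g b ∈ 𝒞 p
  comp_eq_zero : ∀ a, g (f a) = 0
  surjective : ∀ p, ∀ c ∈ 𝒞 p, ∃ b ∈ ℬ p, g b = c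
  exact : ∀ p, ∀ b ∈ ℬ p, g b = 0 → ∃ a ∈ 𝒜 p, f a = b

/-- A degreewise short exact sequence of Koszul complexes. -/
structure KoszulShortExact (𝒜 : ℤ → AddSubgroup A) (ℬ : ℤ → AddSubgroup B)
    (𝒞 : ℤ → AddSubgroup C) (f : A →ₗ[R] B) (g : B →ₗ[R] C) (l : List R) : Prop where
  injective : ∀ a, koszulMap f l a = 0 → a = 0
  map_left : ∀ i p, ∀ a ∈ koszulPart 𝒜 l i p, koszulMap f l a ∈ koszulPart ℬ l i p
  map_right : ∀ i p, ∀ b ∈ koszulPart ℬ l i p, koszulMap g l b ∈ koszulPart 𝒞 l i p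
  comp_eq_zero : ∀ a, koszulMap g l (koszulMap f l a) = 0
  surjective : ∀ i p, ∀ c ∈ koszulPart 𝒞 l i p, ∃ b ∈ koszulPart ℬ l i p, koszulMap g l b = c
  exact : ∀ i p, ∀ b ∈ koszulPart ℬ l i p, koszulMap g l b = 0 →
    ∃ a ∈ koszulPart 𝒜 l i p, koszulMap f l a = b

variable {𝒜 : ℤ → AddSubgroup A} {ℬ : ℤ → AddSubgroup B} {𝒞 : ℤ → AddSubgroup C}
  {f : A →ₗ[R] B} {g : B →ₗ[R] C}

/-- As a module, the Koszul complex is a direct sum of copies of the coefficients, so exactness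
passes to it componentwise. -/
theorem GradedShortExact.koszul (h : GradedShortExact 𝒜 ℬ 𝒞 f g) (l : List R) :
    KoszulShortExact 𝒜 ℬ 𝒞 f g l := by
  induction l with
  | nil =>
    refine ⟨h.injective, fun i p a ha => ?_, fun i p b hb => ?_, h.comp_eq_zero,
      fun i p c hc => ?_, fun i p b hb hb0 => ?_⟩
    · refine (mem_koszulPart_nil ℬ i p _).2 ?_
      rcases (mem_koszulPart_nil 𝒜 i p a).1 ha with ha | ha
      · exact Or.inl ⟨ha.1, h.map_left p a ha.2⟩
      · exact Or.inr (ha ▸ map_zero f)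
    · refine (mem_koszulPart_nil 𝒞 i p _).2 ?_
      rcases (mem_koszulPart_nil ℬ i p b).1 hb with hb | hb
      · exact Or.inl ⟨hb.1, h.map_right p b hb.2⟩
      · exact Or.inr (hb ▸ map_zero g)
    · rcases (mem_koszulPart_nil 𝒞 i p c).1 hc with hc | hc
      · obtain ⟨b, hb, e⟩ := h.surjective p c hc.2
        exact ⟨b, (mem_koszulPart_nil ℬ i p b).2 (Or.inl ⟨hc.1, hb⟩), e⟩
      · exact ⟨0, zero_mem _, by rw [hc, map_zero]; rfl⟩
    · rcases (mem_koszulPart_nil ℬ i p b).1 hb with hb | hb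
      · obtain ⟨a, ha, e⟩ := h.exact p b hb.2 hb0
        exact ⟨a, (mem_koszulPart_nil 𝒜 i p a).2 (Or.inl ⟨hb.1, ha⟩), e⟩
      · exact ⟨0, zero_mem _, by rw [hb, map_zero]; rfl⟩
  | cons x l ih =>
    refine ⟨?_, ?_, ?_, ?_, ?_, ?_⟩
    · rintro ⟨a, a'⟩ h0
      exact Prod.ext (ih.injective a (congrArg Prod.fst h0)) (ih.injective a' (congrArg Prod.snd h0))
    · rintro i p ⟨a, a'⟩ ha
      exact ⟨ih.map_left _ _ _ ha.1, ih.map_left _ _ _ ha.2⟩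
    · rintro i p ⟨a, a'⟩ ha
      exact ⟨ih.map_right _ _ _ ha.1, ih.map_right _ _ _ ha.2⟩
    · rintro ⟨a, a'⟩
      exact Prod.ext (ih.comp_eq_zero a) (ih.comp_eq_zero a')
    · rintro i p ⟨c, c'⟩ hc
      obtain ⟨b, hb, e⟩ := ih.surjective _ _ _ hc.1
      obtain ⟨b', hb', e'⟩ := ih.surjective _ _ _ hc.2
      exact ⟨(b, b'), ⟨hb, hb'⟩, Prod.ext e e'⟩
    · rintro i p ⟨b, b'⟩ hb h0
      obtain ⟨a, ha, e⟩ := ih.exact _ _ _ hb.1 (congrArg Prod.fst h0)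
      obtain ⟨a', ha', e'⟩ := ih.exact _ _ _ hb.2 (congrArg Prod.snd h0)
      exact ⟨(a, a'), ⟨ha, ha'⟩, Prod.ext e e'⟩

theorem KoszulShortExact.eq_of_map_eq {l : List R} (h : KoszulShortExact 𝒜 ℬ 𝒞 f g l)
    {a a' : KoszulModule A l} (e : koszulMap f l a = koszulMap f l a') : a = a' :=
  sub_eq_zero.1 (h.injective _ (by rw [map_sub, e, sub_self]))

/-- This and the next lemmas are the diagram chases of the long exact homology sequence. The
connecting map fixes the internal degree, so it sends `(i, p)` to `(i - 1, p + 1)`. -/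
theorem GradedShortExact.vanishes_middle (h : GradedShortExact 𝒜 ℬ 𝒞 f g) {l : List R}
    (hl : RaisesDegree ℬ l) {i p : ℤ} (hA : KoszulVanishes 𝒜 l i p) (hC : KoszulVanishes 𝒞 l i p) :
    KoszulVanishes ℬ l i p := by
  intro b hb hb0
  have H := h.koszul l
  obtain ⟨c, hc, hcb⟩ := hC (koszulMap g l b) (H.map_right _ _ _ hb)
    (by rw [← koszulMap_koszulD, hb0, map_zero])
  obtain ⟨b', hb', rfl⟩ := H.surjective _ _ _ hc
  have hm : koszulD B l b' ∈ koszulPart ℬ l i p := by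
    simpa using koszulD_mem hl _ _ _ hb'
  obtain ⟨a, ha, hab⟩ := H.exact i p (b - koszulD B l b') (sub_mem hb hm)
    (by rw [map_sub, koszulMap_koszulD, hcb, sub_self])
  obtain ⟨a', ha', rfl⟩ := hA a ha (H.injective _ (by
    rw [koszulMap_koszulD, hab, map_sub, hb0, koszulD_koszulD, sub_self]))
  refine ⟨b' + koszulMap f l a', add_mem hb' (H.map_left _ _ _ ha'), ?_⟩
  rw [map_add, ← koszulMap_koszulD, hab]
  abel

theorem GradedShortExact.vanishes_right (h : GradedShortExact 𝒜 ℬ 𝒞 f g) {l : List R}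
    (hl : RaisesDegree ℬ l) {i p : ℤ} (hB : KoszulVanishes ℬ l i p)
    (hA : KoszulVanishes 𝒜 l (i - 1) (p + 1)) : KoszulVanishes 𝒞 l i p := by
  intro c hc hc0
  have H := h.koszul l
  obtain ⟨b, hb, rfl⟩ := H.surjective _ _ _ hc
  obtain ⟨a, ha, hab⟩ := H.exact _ _ _ (koszulD_mem hl _ _ _ hb) (by rw [koszulMap_koszulD, hc0])
  obtain ⟨a', ha', rfl⟩ := hA a ha (H.injective _ (by
    rw [koszulMap_koszulD, hab, koszulD_koszulD]))
  rw [sub_add_cancel, add_sub_cancel_right] at ha'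
  obtain ⟨b', hb', e⟩ := hB (b - koszulMap f l a') (sub_mem hb (H.map_left _ _ _ ha')) (by
    rw [map_sub, ← koszulMap_koszulD, hab, sub_self])
  refine ⟨koszulMap g l b', H.map_right _ _ _ hb', ?_⟩
  rw [← koszulMap_koszulD, e, map_sub, H.comp_eq_zero, sub_zero]

/-- Only the map on homology from `A` to `B` has to be zero. This is needed for syzygies in
homological degree `0`, where the homology of a free module does not vanish but minimality kills the
map. -/
theorem GradedShortExact.vanishes_left' (h : GradedShortExact 𝒜 ℬ 𝒞 f g) {l : List R}
    (hl : RaisesDegree ℬ l) {i p : ℤ}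
    (hB : ∀ a ∈ koszulPart 𝒜 l i p, koszulD A l a = 0 →
      ∃ b ∈ koszulPart ℬ l (i + 1) (p - 1), koszulD B l b = koszulMap f l a)
    (hC : KoszulVanishes 𝒞 l (i + 1) (p - 1)) : KoszulVanishes 𝒜 l i p := by
  intro a ha ha0
  have H := h.koszul l
  obtain ⟨b, hb, e⟩ := hB a ha ha0
  obtain ⟨c, hc, e'⟩ := hC (koszulMap g l b) (H.map_right _ _ _ hb) (by
    rw [← koszulMap_koszulD, e, H.comp_eq_zero])
  obtain ⟨b', hb', rfl⟩ := H.surjective _ _ _ hc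
  have hm : koszulD B l b' ∈ koszulPart ℬ l (i + 1) (p - 1) := by
    simpa using koszulD_mem hl _ _ _ hb'
  obtain ⟨a', ha', e''⟩ := H.exact _ _ (b - koszulD B l b') (sub_mem hb hm) (by
    rw [map_sub, koszulMap_koszulD, e', sub_self])
  refine ⟨a', ha', H.eq_of_map_eq ?_⟩
  rw [koszulMap_koszulD, e'', map_sub, koszulD_koszulD, sub_zero, e]

theorem GradedShortExact.vanishes_left (h : GradedShortExact 𝒜 ℬ 𝒞 f g) {l : List R}
    (hl : RaisesDegree ℬ l) {i p : ℤ} (hB : KoszulVanishes ℬ l i p)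
    (hC : KoszulVanishes 𝒞 l (i + 1) (p - 1)) : KoszulVanishes 𝒜 l i p :=
  h.vanishes_left' hl (fun a ha ha0 => hB _ ((h.koszul l).map_left _ _ _ ha) (by
    rw [← koszulMap_koszulD, ha0, map_zero])) hC

/-- The inclusion of `M` as the part of homological degree zero. -/
def koszulInl (M : Type*) [AddCommGroup M] [Module R M] :
    (l : List R) → M →ₗ[R] KoszulModule M l
  | [] => LinearMap.id
  | _ :: l => LinearMap.inl R (KoszulModule M l) (KoszulModule M l) ∘ₗ koszulInl M l

/-- The graded piece of degree `p` of `(l) M`. -/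
def listSMulPart (𝒜 : ℤ → AddSubgroup M) : List R → ℤ → AddSubgroup M
  | [], _ => ⊥
  | x :: l, p => (𝒜 (p - 1)).map (DistribSMul.toAddMonoidHom M x) ⊔ listSMulPart 𝒜 l p

theorem mem_listSMulPart_cons (𝒜 : ℤ → AddSubgroup M) (x : R) (l : List R) (p : ℤ) (v : M) :
    v ∈ listSMulPart 𝒜 (x :: l) p ↔ ∃ y ∈ 𝒜 (p - 1), ∃ z ∈ listSMulPart 𝒜 l p, x • y + z = v := by
  simp only [listSMulPart, AddSubgroup.mem_sup, AddSubgroup.mem_map, exists_exists_and_eq_and]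
  rfl

theorem koszulInl_cons (x : R) (l : List R) (a : M) :
    koszulInl M (x :: l) a = (koszulInl M l a, 0) := rfl

theorem koszulInl_injective (l : List R) : Function.Injective (koszulInl M l) := by
  induction l with
  | nil => exact fun _ _ h => h
  | cons x l ih => exact fun _ _ h => ih (congrArg Prod.fst h)

theorem koszulInl_mem (𝒜 : ℤ → AddSubgroup M) (l : List R) (p : ℤ) (a : M) (ha : a ∈ 𝒜 p) :
    koszulInl M l a ∈ koszulPart 𝒜 l 0 p := by
  induction l with
  | nil => exact (mem_koszulPart_nil 𝒜 0 p a).2 (Or.inl ⟨rfl, ha⟩)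
  | cons x l ih => exact ⟨ih, zero_mem _⟩

theorem exists_koszulInl (𝒜 : ℤ → AddSubgroup M) (l : List R) (p : ℤ) (c : KoszulModule M l)
    (hc : c ∈ koszulPart 𝒜 l 0 p) : ∃ a ∈ 𝒜 p, koszulInl M l a = c := by
  induction l with
  | nil =>
    rcases (mem_koszulPart_nil 𝒜 0 p c).1 hc with h | h
    · exact ⟨c, h.2, rfl⟩
    · exact ⟨0, zero_mem _, h.symm⟩
  | cons x l ih =>
    obtain ⟨c, c'⟩ := c
    obtain ⟨a, ha, e⟩ := ih c hc.1
    exact ⟨a, ha, Prod.ext e (koszulPart_of_neg 𝒜 l (by omega) p c' hc.2).symm⟩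

theorem koszulD_koszulInl (l : List R) (a : M) : koszulD M l (koszulInl M l a) = 0 := by
  induction l with
  | nil => rfl
  | cons x l ih =>
    rw [koszulInl_cons, koszulD_cons, ih, smul_zero, map_zero, neg_zero, add_zero]
    rfl

theorem koszulMap_koszulInl (f : M →ₗ[R] N) (l : List R) (a : M) :
    koszulMap f l (koszulInl M l a) = koszulInl N l (f a) := by
  induction l with
  | nil => rfl
  | cons x l ih =>
    rw [koszulInl_cons, koszulMap_cons, ih, map_zero]
    rfl

/-- This identifies `H_0` with `M / (l) M`, degree by degree. -/
theorem koszulInl_boundary_iff (𝒜 : ℤ → AddSubgroup M) (l : List R) (p : ℤ) (a : M) :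
    (∃ b ∈ koszulPart 𝒜 l 1 (p - 1), koszulD M l b = koszulInl M l a) ↔
      a ∈ listSMulPart 𝒜 l p := by
  induction l generalizing a with
  | nil =>
    constructor
    · rintro ⟨b, -, e⟩
      exact e.symm
    · rintro h
      obtain rfl : a = 0 := h
      exact ⟨0, zero_mem _, rfl⟩
  | cons x l ih =>
    rw [mem_listSMulPart_cons]
    constructor
    · rintro ⟨⟨b, b'⟩, hb, e⟩
      obtain ⟨y, hy, rfl⟩ := exists_koszulInl 𝒜 l (p - 1) b' hb.2
      refine ⟨y, hy, a - x • y, (ih _).1 ⟨b, hb.1, ?_⟩, by abel⟩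
      have e1 : koszulD M l b + x • koszulInl M l y = koszulInl M l a := congrArg Prod.fst e
      rw [map_sub, map_smul, ← e1]
      abel
    · rintro ⟨y, hy, z, hz, rfl⟩
      obtain ⟨b, hb, e⟩ := (ih z).2 hz
      refine ⟨(b, koszulInl M l y), ⟨hb, koszulInl_mem 𝒜 l _ y hy⟩, ?_⟩
      rw [koszulD_cons, e, koszulD_koszulInl, koszulInl_cons, map_add, map_smul, neg_zero, add_comm]

theorem koszulVanishes_zero_iff (𝒜 : ℤ → AddSubgroup M) (l : List R) (p : ℤ) :
    KoszulVanishes 𝒜 l 0 p ↔ ∀ a ∈ 𝒜 p, a ∈ listSMulPart 𝒜 l p := by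
  constructor
  · intro h a ha
    exact (koszulInl_boundary_iff 𝒜 l p a).1
      (h _ (koszulInl_mem 𝒜 l p a ha) (koszulD_koszulInl l a))
  · intro h c hc _
    obtain ⟨a, ha, rfl⟩ := exists_koszulInl 𝒜 l p c hc
    exact (koszulInl_boundary_iff 𝒜 l p a).2 (h a ha)

/-- The Koszul complex is acyclic for sequences that are regular in every degree. -/
theorem koszulVanishes_cons {𝒜 : ℤ → AddSubgroup M} {x : R} {l : List R}
    (hl : RaisesDegree 𝒜 (x :: l))
    (ih : ∀ i p, 1 ≤ i → KoszulVanishes 𝒜 l i p)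
    (hx : ∀ p, ∀ y ∈ 𝒜 p, x • y ∈ listSMulPart 𝒜 l (p + 1) → y ∈ listSMulPart 𝒜 l p)
    (i p : ℤ) (hi : 1 ≤ i) : KoszulVanishes 𝒜 (x :: l) i p := by
  rintro ⟨a, b⟩ hc h0
  have h1 : koszulD M l a + x • b = 0 := congrArg Prod.fst h0
  have h2 : koszulD M l b = 0 := neg_eq_zero.1 (congrArg Prod.snd h0)
  -- The second component is a boundary: for `i ≥ 2` by acyclicity for `l`, for `i = 1` because `x`
  -- is a nonzerodivisor modulo `(l)`. Then `a + x • b'` is a cycle for `l`.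
  obtain ⟨b', hb', e⟩ : ∃ b' ∈ koszulPart 𝒜 l i (p - 1), koszulD M l b' = b := by
    rcases eq_or_lt_of_le hi with rfl | hi
    · have hb : b ∈ koszulPart 𝒜 l 0 p := hc.2
      obtain ⟨y, hy, rfl⟩ := exists_koszulInl 𝒜 l p b hb
      refine (koszulInl_boundary_iff 𝒜 l p y).2 (hx p y hy
        ((koszulInl_boundary_iff 𝒜 l (p + 1) _).1 ⟨-a, ?_, ?_⟩))
      · rw [add_sub_cancel_right]
        exact neg_mem hc.1
      · rw [map_neg, map_smul]
        exact neg_eq_of_add_eq_zero_right h1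
    · simpa using ih (i - 1) p (by omega) b hc.2 h2
  obtain ⟨a', ha', e'⟩ := ih i p hi (a + x • b')
    (add_mem hc.1 (by
      simpa using smul_mem_koszulPart (hl x List.mem_cons_self) l i (p - 1) b' hb'))
    (by rw [map_add, map_smul, e, h1])
  refine ⟨(a', -b'), ⟨ha', ?_⟩, ?_⟩
  · rw [add_sub_cancel_right]
    exact (koszulPart 𝒜 l _ _).neg_mem hb'
  · rw [koszulD_cons, e', map_neg, e, smul_neg, neg_neg, add_neg_cancel_right]

end Koszul


/-! ### Graded free modules and the acyclicity of their Koszul complexes -/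

section FreeModules

variable {K : Type*} [Field K] {n : ℕ}

/-- The vectors in `⨁_k S(-s k)` all of whose terms have degree in `T`. -/
def degreesIn {r : ℕ} (s : Fin r → ℕ) (T : Set ℕ) :
    AddSubgroup (Fin r → MvPolynomial (Fin n) K) where
  carrier := {v | ∀ k, ∀ m ∈ (v k).support, m.degree + s k ∈ T}
  zero_mem' := by intro k m hm; simp at hm
  add_mem' := by
    intro v w hv hw k m hm
    rcases Finset.mem_union.1 (support_add hm) with h | h
    · exact hv k m h
    · exact hw k m h
  neg_mem' := by
    intro v hv k m hm
    rw [Pi.neg_apply, support_neg] at hm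
    exact hv k m hm

/-- The graded piece of degree `p` of `⨁_k S(-s k)`. -/
def freePart {r : ℕ} (s : Fin r → ℕ) (p : ℤ) : AddSubgroup (Fin r → MvPolynomial (Fin n) K) :=
  degreesIn s {q | (q : ℤ) = p}

theorem mem_freePart {r : ℕ} {s : Fin r → ℕ} {p : ℤ} {v : Fin r → MvPolynomial (Fin n) K} :
    v ∈ freePart s p ↔ ∀ k, ∀ m ∈ (v k).support, ((m.degree + s k : ℕ) : ℤ) = p := Iff.rfl

theorem freePart_of_neg {r : ℕ} (s : Fin r → ℕ) {p : ℤ} (hp : p < 0) :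
    (freePart s p : AddSubgroup (Fin r → MvPolynomial (Fin n) K)) = ⊥ := by
  rw [eq_bot_iff]
  intro v hv
  rw [AddSubgroup.mem_bot]
  funext k
  by_contra h
  obtain ⟨m, hm⟩ := support_nonempty.2 h
  have := hv k m hm
  simp only [Set.mem_ofPred_eq] at this
  omega

/-- A map of free graded modules that preserves degrees. -/
def IsGradedMap {r r' : ℕ} (s : Fin r → ℕ) (s' : Fin r' → ℕ)
    (φ : (Fin r → MvPolynomial (Fin n) K) →ₗ[MvPolynomial (Fin n) K]
      (Fin r' → MvPolynomial (Fin n) K)) : Prop :=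
  ∀ k l, ∀ m ∈ (φ (Pi.single l 1) k).support, m.degree + s' k = s l

theorem exists_polynomial_split (P : (Fin n →₀ ℕ) → Prop) (f : MvPolynomial (Fin n) K) :
    ∃ g h : MvPolynomial (Fin n) K, (∀ m ∈ g.support, P m) ∧ (∀ m ∈ h.support, ¬ P m) ∧
      g + h = f := by
  induction f using MvPolynomial.induction_on' with
  | monomial u a =>
    have key : ∀ m ∈ (monomial u a : MvPolynomial (Fin n) K).support, m = u := fun m hm =>
      Finset.mem_singleton.1 (support_monomial_subset hm)
    by_cases h : P u
    · exact ⟨monomial u a, 0, fun m hm => key m hm ▸ h, fun m hm => by simp at hm, add_zero _⟩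
    · exact ⟨0, monomial u a, fun m hm => by simp at hm, fun m hm => key m hm ▸ h, zero_add _⟩
  | add p q hp hq =>
    obtain ⟨g, h, hg, hh, rfl⟩ := hp
    obtain ⟨g', h', hg', hh', rfl⟩ := hq
    refine ⟨g + g', h + h', fun m hm => ?_, fun m hm => ?_, by abel⟩
    · exact (Finset.mem_union.1 (support_add hm)).elim (hg m) (hg' m)
    · exact (Finset.mem_union.1 (support_add hm)).elim (hh m) (hh' m)

/-- Splitting along a set of degrees and its complement replaces the full decomposition into
homogeneous components throughout. -/
theorem exists_degreesIn_split {r : ℕ} (s : Fin r → ℕ) (T : Set ℕ)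
    (v : Fin r → MvPolynomial (Fin n) K) :
    ∃ w ∈ degreesIn s T, ∃ w' ∈ degreesIn s Tᶜ, w + w' = v := by
  choose g h hg hh e using fun k => exists_polynomial_split (fun m => m.degree + s k ∈ T) (v k)
  exact ⟨g, hg, h, hh, funext e⟩

theorem eq_zero_of_mem_degreesIn {r : ℕ} {s : Fin r → ℕ} {T : Set ℕ}
    {v : Fin r → MvPolynomial (Fin n) K} (h : v ∈ degreesIn s T) (h' : v ∈ degreesIn s Tᶜ) :
    v = 0 := by
  funext k
  by_contra h0
  obtain ⟨m, hm⟩ := support_nonempty.2 h0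
  exact h' k m hm (h k m hm)

theorem IsGradedMap.map_mem {r r' : ℕ} {s : Fin r → ℕ} {s' : Fin r' → ℕ}
    {φ : (Fin r → MvPolynomial (Fin n) K) →ₗ[MvPolynomial (Fin n) K]
      (Fin r' → MvPolynomial (Fin n) K)} (h : IsGradedMap s s' φ) {T : Set ℕ}
    {v : Fin r → MvPolynomial (Fin n) K} (hv : v ∈ degreesIn s T) : φ v ∈ degreesIn s' T := by
  have e : φ v = ∑ l, v l • φ (Pi.single l 1) := by
    conv_lhs => rw [← Finset.univ_sum_single v, map_sum]
    refine Finset.sum_congr rfl fun l _ => ?_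
    rw [← map_smul, ← Pi.single_smul, smul_eq_mul, mul_one]
  rw [e]
  refine sum_mem fun l _ k m hm => ?_
  rw [Pi.smul_apply, smul_eq_mul] at hm
  obtain ⟨a, ha, b, hb, rfl⟩ := Finset.mem_add.1 (support_mul _ _ hm)
  rw [map_add, add_assoc, h k l b hb]
  exact hv l a ha

theorem IsGradedMap.exists_preimage {r r' : ℕ} {s : Fin r → ℕ} {s' : Fin r' → ℕ}
    {φ : (Fin r → MvPolynomial (Fin n) K) →ₗ[MvPolynomial (Fin n) K]
      (Fin r' → MvPolynomial (Fin n) K)} (h : IsGradedMap s s' φ) {T : Set ℕ}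
    {v : Fin r' → MvPolynomial (Fin n) K} (hv : v ∈ degreesIn s' T)
    (hr : v ∈ LinearMap.range φ) : ∃ w ∈ degreesIn s T, φ w = v := by
  obtain ⟨u, rfl⟩ := hr
  obtain ⟨w, hw, w', hw', rfl⟩ := exists_degreesIn_split s T u
  refine ⟨w, hw, ?_⟩
  have h0 : φ w' = 0 := by
    refine eq_zero_of_mem_degreesIn ?_ (h.map_mem hw')
    rw [← add_sub_cancel_left (φ w) (φ w'), ← map_add]
    exact sub_mem hv (h.map_mem hw)
  rw [map_add, h0, add_zero]

theorem mem_irrelevant {f : MvPolynomial (Fin n) K} : f ∈ irrelevant K n ↔ coeff 0 f = 0 := by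
  rw [irrelevant, ← Set.image_univ, mem_ideal_span_X_image]
  constructor
  · intro h
    by_contra h0
    obtain ⟨i, -, hi⟩ := h 0 (mem_support_iff.2 h0)
    exact hi rfl
  · intro h m hm
    by_contra! h0
    have : m = 0 := Finsupp.ext fun i => h0 i trivial
    exact mem_support_iff.1 hm (this ▸ h)

theorem mem_irrelevant_smul_top {r : ℕ} {v : Fin r → MvPolynomial (Fin n) K} :
    v ∈ irrelevant K n • (⊤ : Submodule (MvPolynomial (Fin n) K)
      (Fin r → MvPolynomial (Fin n) K)) ↔ ∀ k, coeff 0 (v k) = 0 := by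
  constructor
  · intro h k
    rw [← mem_irrelevant]
    induction h using Submodule.smul_induction_on' with
    | smul a ha w _ => exact Ideal.mul_mem_right _ _ ha
    | add w _ w' _ h h' => exact add_mem h h'
  · intro h
    rw [← Finset.univ_sum_single v]
    refine sum_mem fun k _ => ?_
    have : (Pi.single k (v k) : Fin r → MvPolynomial (Fin n) K) = v k • Pi.single k 1 := by
      rw [← Pi.single_smul, smul_eq_mul, mul_one]
    rw [this]
    exact Submodule.smul_mem_smul (mem_irrelevant.2 (h k)) trivial

theorem mem_support_X_mul {i : Fin n} {f : MvPolynomial (Fin n) K} {m : Fin n →₀ ℕ} :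
    m ∈ (X i * f).support ↔ ∃ m' ∈ f.support, Finsupp.single i 1 + m' = m := by
  rw [support_X_mul, Finset.mem_map]
  rfl

theorem raisesDegree_freePart {r : ℕ} (s : Fin r → ℕ) (L : List (Fin n)) :
    RaisesDegree (freePart (K := K) (n := n) s) (L.map (X : Fin n → MvPolynomial (Fin n) K)) := by
  intro x hx p v hv k m hm
  obtain ⟨i, -, rfl⟩ := List.mem_map.1 hx
  rw [Pi.smul_apply, smul_eq_mul, mem_support_X_mul] at hm
  obtain ⟨m', hm', rfl⟩ := hm
  have := hv k m' hm'
  simp only [Set.mem_ofPred_eq, map_add, Finsupp.degree_single] at this ⊢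
  omega

/-- Membership in `(L) F` is a condition on single monomials. This makes it evident that a variable
outside `L` is a nonzerodivisor modulo `(L)`. -/
theorem mem_listSMulPart_freePart {r : ℕ} {s : Fin r → ℕ} {L : List (Fin n)} {p : ℤ}
    {v : Fin r → MvPolynomial (Fin n) K} :
    v ∈ listSMulPart (freePart s) (L.map (X : Fin n → MvPolynomial (Fin n) K)) p ↔
      v ∈ freePart s p ∧ ∀ k, ∀ m ∈ (v k).support, ∃ i ∈ L, m i ≠ 0 := by
  induction L generalizing v with
  | nil =>
    constructor
    · rintro h
      obtain rfl : v = 0 := h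
      exact ⟨zero_mem _, fun k m hm => by simp at hm⟩
    · rintro ⟨-, h⟩
      refine funext fun k => ?_
      by_contra h0
      obtain ⟨m, hm⟩ := support_nonempty.2 h0
      simpa using h k m hm
  | cons i L ih =>
    rw [List.map_cons, mem_listSMulPart_cons]
    constructor
    · rintro ⟨y, hy, z, hz, rfl⟩
      obtain ⟨hz, hz'⟩ := ih.1 hz
      refine ⟨add_mem ?_ hz, fun k m hm => ?_⟩
      · simpa using raisesDegree_freePart s [i] (X i) (by simp) _ y hy
      · rcases Finset.mem_union.1 (support_add hm) with h | h
        · rw [Pi.smul_apply, smul_eq_mul, mem_support_X_mul] at h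
          obtain ⟨m', hm', rfl⟩ := h
          exact ⟨i, List.mem_cons_self, by simp⟩
        · obtain ⟨j, hj, h⟩ := hz' k m h
          exact ⟨j, List.mem_cons_of_mem _ hj, h⟩
    · rintro ⟨hv, h⟩
      refine ⟨fun k => (v k).divMonomial (Finsupp.single i 1), fun k m hm => ?_,
        fun k => (v k).modMonomial (Finsupp.single i 1), ih.2 ⟨fun k m hm => ?_, fun k m hm => ?_⟩,
        funext fun k => divMonomial_add_modMonomial_single _ _⟩
      · rw [mem_support_iff, coeff_divMonomial, ← mem_support_iff] at hm
        have := hv k _ hm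
        simp only [Set.mem_ofPred_eq, map_add, Finsupp.degree_single] at this ⊢
        omega
      all_goals
        have hi : ¬ Finsupp.single i 1 ≤ m := fun hi =>
          mem_support_iff.1 hm (coeff_modMonomial_of_le _ hi)
        rw [mem_support_iff, coeff_modMonomial_of_not_le _ hi, ← mem_support_iff] at hm
      · exact hv k m hm
      · obtain ⟨j, hj, h⟩ := h k m hm
        rcases List.mem_cons.1 hj with rfl | hj
        · refine absurd (Finsupp.single_le_iff.2 ?_) hi
          omega
        · exact ⟨j, hj, h⟩

theorem koszulVanishes_freePart {r : ℕ} (s : Fin r → ℕ) {L : List (Fin n)} (hL : L.Nodup) (i p : ℤ)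
    (hi : 1 ≤ i) :
    KoszulVanishes (freePart (K := K) (n := n) s) (L.map (X : Fin n → MvPolynomial (Fin n) K)) i p := by
  induction L generalizing i p with
  | nil =>
    intro c hc _
    rcases (mem_koszulPart_nil _ i p c).1 hc with h | h
    · omega
    · exact ⟨0, zero_mem _, h.symm⟩
  | cons x L ih =>
    obtain ⟨hx, hL⟩ := List.nodup_cons.1 hL
    refine koszulVanishes_cons (raisesDegree_freePart s (x :: L)) (fun i p hi => ih hL i p hi)
      (fun p y hy h => ?_) i p hi
    refine mem_listSMulPart_freePart.2 ⟨hy, fun k m hm => ?_⟩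
    obtain ⟨j, hj, h⟩ := (mem_listSMulPart_freePart.1 h).2 k (Finsupp.single x 1 + m) (by
      rw [Pi.smul_apply, smul_eq_mul, mem_support_X_mul]
      exact ⟨m, hm, rfl⟩)
    refine ⟨j, hj, ?_⟩
    rwa [Finsupp.add_apply, Finsupp.single_eq_of_ne (show j ≠ x from fun e => hx (e ▸ hj)), zero_add] at h

/-- The list `[x_1, …, x_n]` of all polyVariables. -/
def polyVariables (K : Type*) [Field K] (n : ℕ) : List (MvPolynomial (Fin n) K) :=
  (List.finRange n).map X

theorem koszulVanishes_free {r : ℕ} (s : Fin r → ℕ) (i p : ℤ) (hi : 1 ≤ i) :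
    KoszulVanishes (freePart (K := K) (n := n) s) (polyVariables K n) i p :=
  koszulVanishes_freePart s (List.nodup_finRange n) i p hi

theorem mem_listSMulPart_variables {r : ℕ} {s : Fin r → ℕ} {p : ℤ}
    {v : Fin r → MvPolynomial (Fin n) K} :
    v ∈ listSMulPart (freePart s) (polyVariables K n) p ↔
      v ∈ freePart s p ∧ ∀ k, coeff 0 (v k) = 0 := by
  rw [polyVariables, mem_listSMulPart_freePart]
  refine and_congr_right fun _ => forall_congr' fun k => ?_
  rw [← mem_irrelevant, irrelevant, ← Set.image_univ, mem_ideal_span_X_image]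
  simp

theorem raisesDegree_free {r : ℕ} (s : Fin r → ℕ) :
    RaisesDegree (freePart (K := K) (n := n) s) (polyVariables K n) :=
  raisesDegree_freePart s _

end FreeModules


/-! ### Betti numbers as Koszul homology -/

section Resolutions

variable {K : Type*} [Field K] {n : ℕ}

theorem koszulVanishes_of_neg {R M : Type*} [CommRing R] [AddCommGroup M] [Module R M]
    (𝒜 : ℤ → AddSubgroup M) (l : List R) {i : ℤ} (hi : i < 0) (p : ℤ) :
    KoszulVanishes 𝒜 l i p := fun c hc _ =>
  ⟨0, zero_mem _, by rw [koszulPart_of_neg 𝒜 l hi p c hc, map_zero]⟩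

/-- The grading of a submodule of a free graded module. -/
def subPart {r : ℕ} (s : Fin r → ℕ)
    (Z : Submodule (MvPolynomial (Fin n) K) (Fin r → MvPolynomial (Fin n) K)) (p : ℤ) :
    AddSubgroup Z :=
  (freePart s p).comap Z.subtype.toAddMonoidHom

theorem IsGradedMap.gradedShortExact {r r' : ℕ} {s : Fin r → ℕ} {s' : Fin r' → ℕ}
    {φ : (Fin r → MvPolynomial (Fin n) K) →ₗ[MvPolynomial (Fin n) K]
      (Fin r' → MvPolynomial (Fin n) K)} (h : IsGradedMap s s' φ) :
    GradedShortExact (subPart s (LinearMap.ker φ)) (freePart s) (subPart s' (LinearMap.range φ))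
      (LinearMap.ker φ).subtype φ.rangeRestrict where
  injective _ ha := Subtype.ext ha
  map_left _ _ ha := ha
  map_right _ _ hb := h.map_mem hb
  comp_eq_zero a := Subtype.ext a.2
  surjective _ c hc := by
    obtain ⟨w, hw, e⟩ := h.exists_preimage hc c.2
    exact ⟨w, hw, Subtype.ext e⟩
  exact _ b hb h0 := ⟨⟨b, congrArg Subtype.val h0⟩, hb, rfl⟩

/-- Dimension shift along `0 → ker φ → F → range φ → 0`. The free module has no higher homology, and
for `i = 0` the map `H_0(ker φ) → H_0(F) = F/𝔪F` is zero by minimality. -/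
theorem IsGradedMap.vanishes_range_iff {r r' : ℕ} {s : Fin r → ℕ} {s' : Fin r' → ℕ}
    {φ : (Fin r → MvPolynomial (Fin n) K) →ₗ[MvPolynomial (Fin n) K]
      (Fin r' → MvPolynomial (Fin n) K)} (h : IsGradedMap s s' φ)
    (hmin : LinearMap.ker φ ≤ irrelevant K n • ⊤) (i p : ℤ) (hi : 0 ≤ i) :
    KoszulVanishes (subPart s' (LinearMap.range φ)) (polyVariables K n) (i + 1) p ↔
      KoszulVanishes (subPart s (LinearMap.ker φ)) (polyVariables K n) i (p + 1) := by
  have H := h.gradedShortExact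
  constructor
  · intro hV
    refine H.vanishes_left' (raisesDegree_free s) (fun a ha ha0 => ?_) (by simpa using hV)
    rcases eq_or_lt_of_le hi with rfl | hi
    · obtain ⟨z, hz, rfl⟩ := exists_koszulInl _ _ _ a ha
      rw [koszulMap_koszulInl]
      exact (koszulInl_boundary_iff _ _ _ _).2 (mem_listSMulPart_variables.2
        ⟨hz, mem_irrelevant_smul_top.1 (hmin z.2)⟩)
    · exact koszulVanishes_free s i (p + 1) hi _ ((H.koszul _).map_left _ _ _ ha)
        (by rw [← koszulMap_koszulD, ha0, map_zero])
  · intro hV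
    exact H.vanishes_right (raisesDegree_free s) (koszulVanishes_free s _ p (by omega))
      (by simpa using hV)

theorem koszulVanishes_free_zero {r : ℕ} {s : Fin r → ℕ} {p : ℤ} (h : ∀ k, (s k : ℤ) ≠ p) :
    KoszulVanishes (freePart (K := K) (n := n) s) (polyVariables K n) 0 p := by
  refine (koszulVanishes_zero_iff _ _ p).2 fun v hv => mem_listSMulPart_variables.2 ⟨hv, fun k => ?_⟩
  by_contra h0
  have := mem_freePart.1 hv k 0 (mem_support_iff.2 h0)
  rw [map_zero, zero_add] at this
  exact h k this

/-- By minimality `H_0(range φ) = F/𝔪F`, whose degrees are exactly the shifts of `F`. -/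
theorem IsGradedMap.vanishes_range_zero_iff {r r' : ℕ} {s : Fin r → ℕ} {s' : Fin r' → ℕ}
    {φ : (Fin r → MvPolynomial (Fin n) K) →ₗ[MvPolynomial (Fin n) K]
      (Fin r' → MvPolynomial (Fin n) K)} (h : IsGradedMap s s' φ)
    (hmin : LinearMap.ker φ ≤ irrelevant K n • ⊤) (p : ℤ) :
    KoszulVanishes (subPart s' (LinearMap.range φ)) (polyVariables K n) 0 p ↔
      ∀ k, (s k : ℤ) ≠ p := by
  have H := h.gradedShortExact
  constructor
  · rintro hV k rfl
    have he : (Pi.single k 1 : Fin r → MvPolynomial (Fin n) K) ∈ freePart s (s k) := by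
      rw [mem_freePart]
      intro k' m hm
      by_cases hk : k' = k
      · subst hk
        rw [Pi.single_eq_same, ← C_1] at hm
        have : m = 0 := by
          by_contra h0
          exact mem_support_iff.1 hm (by rw [coeff_C, if_neg (Ne.symm h0)])
        simp [this]
      · rw [Pi.single_eq_of_ne hk] at hm
        simp at hm
    -- If the class of the basis vector `e_k` vanished, then `e_k ∈ 𝔪F + ker φ ⊆ 𝔪F`, contradicting
    -- its constant coefficient `1`.
    obtain ⟨b, hb, e⟩ := hV _ (koszulInl_mem _ _ _ _ (H.map_right _ _ he)) (koszulD_koszulInl _ _)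
    obtain ⟨b', hb', rfl⟩ := (H.koszul _).surjective _ _ _ hb
    have hD := koszulD_mem (raisesDegree_free s) _ _ _ hb'
    rw [sub_add_cancel, zero_add, sub_self] at hD
    obtain ⟨w, hw, e'⟩ := exists_koszulInl _ _ _ _ hD
    have hw' := (mem_listSMulPart_variables.1
      ((koszulInl_boundary_iff _ _ _ _).1 ⟨b', by simpa using hb', e'.symm⟩)).2 k
    rw [← koszulMap_koszulD, ← e', koszulMap_koszulInl] at e
    have e2 := congrArg Subtype.val (koszulInl_injective _ e)
    have hk : Pi.single k 1 - w ∈ LinearMap.ker φ := by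
      rw [LinearMap.mem_ker, map_sub, sub_eq_zero]
      exact e2.symm
    have := mem_irrelevant_smul_top.1 (hmin hk) k
    rw [Pi.sub_apply, coeff_sub, hw', Pi.single_eq_same] at this
    simp at this
  · intro hs
    exact H.vanishes_right (raisesDegree_free s) (koszulVanishes_free_zero hs)
      (koszulVanishes_of_neg _ _ (by omega) _)

/-- The graded piece of degree `p` of `S / I`. -/
def quotPart (I : Ideal (MvPolynomial (Fin n) K)) (p : ℤ) : AddSubgroup (MvPolynomial (Fin n) K ⧸ I) :=
  (freePart (fun _ : Fin 1 => 0) p).map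
    (I.mkQ ∘ₗ LinearMap.proj (R := MvPolynomial (Fin n) K)
      (φ := fun _ : Fin 1 => MvPolynomial (Fin n) K) 0).toAddMonoidHom

/-- An ideal as a submodule of `S^1`. -/
def idealSubmodule (I : Ideal (MvPolynomial (Fin n) K)) :
    Submodule (MvPolynomial (Fin n) K) (Fin 1 → MvPolynomial (Fin n) K) :=
  Submodule.comap (LinearMap.proj 0) I

theorem gradedShortExact_quotient (I : Ideal (MvPolynomial (Fin n) K)) :
    GradedShortExact (subPart (fun _ => 0) (idealSubmodule I)) (freePart (fun _ : Fin 1 => 0))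
      (quotPart I) (idealSubmodule I).subtype
      (I.mkQ ∘ₗ LinearMap.proj (R := MvPolynomial (Fin n) K)
        (φ := fun _ : Fin 1 => MvPolynomial (Fin n) K) 0) where
  injective _ ha := Subtype.ext ha
  map_left _ _ ha := ha
  map_right _ b hb := ⟨b, hb, rfl⟩
  comp_eq_zero a := (Submodule.Quotient.mk_eq_zero I).2 a.2
  surjective _ _ hc := hc
  exact _ b hb h0 := ⟨⟨b, (Submodule.Quotient.mk_eq_zero I).1 h0⟩, hb, rfl⟩

/-- The excluded case `i = 0`, `p = -1` is where `H_0(S) = K` in degree `0` interferes; for `I = S`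
the equivalence fails there. -/
theorem vanishes_quotient_iff (I : Ideal (MvPolynomial (Fin n) K)) {i p : ℤ}
    (h : 1 ≤ i ∨ (0 ≤ i ∧ p ≠ -1)) :
    KoszulVanishes (quotPart I) (polyVariables K n) (i + 1) p ↔
      KoszulVanishes (subPart (fun _ => 0) (idealSubmodule I)) (polyVariables K n) i (p + 1) := by
  have H := gradedShortExact_quotient I
  constructor
  · intro hV
    refine H.vanishes_left (raisesDegree_free _) ?_ (by simpa using hV)
    by_cases hi : 1 ≤ i
    · exact koszulVanishes_free _ _ _ hi
    · obtain rfl : i = 0 := by omega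
      refine koszulVanishes_free_zero fun _ => ?_
      simp only [Nat.cast_zero]
      omega
  · intro hV
    exact H.vanishes_right (raisesDegree_free _) (koszulVanishes_free _ _ _ (by omega))
      (by simpa using hV)

namespace MinimalGradedFreeResolution

variable {I : Ideal (MvPolynomial (Fin n) K)} (F : MinimalGradedFreeResolution I)

/-- The augmentation with target `S^1`. -/
def augmentation : (Fin (F.rank 0) → MvPolynomial (Fin n) K) →ₗ[MvPolynomial (Fin n) K]
    (Fin 1 → MvPolynomial (Fin n) K) :=
  LinearMap.pi fun _ => F.ε

theorem isGradedMap_augmentation : IsGradedMap (F.shift 0) (fun _ => 0) F.augmentation := by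
  intro k l m hm
  have := F.ε_homogeneous l (mem_support_iff.1 hm)
  rw [add_zero, Finsupp.degree_eq_weight_one]
  exact this

theorem range_augmentation : LinearMap.range F.augmentation = idealSubmodule I := by
  ext v
  rw [idealSubmodule, Submodule.mem_comap, LinearMap.mem_range]
  have hr := F.range_ε
  constructor
  · rintro ⟨w, rfl⟩
    exact hr.le ⟨w, rfl⟩
  · intro h
    obtain ⟨w, hw⟩ := hr.ge h
    refine ⟨w, funext fun k => ?_⟩
    rw [Subsingleton.elim k 0]
    exact hw

theorem ker_augmentation : LinearMap.ker F.augmentation = LinearMap.range (F.d 0) := by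
  rw [← F.exact_zero.linearMap_ker_eq]
  ext v
  rw [LinearMap.mem_ker, LinearMap.mem_ker]
  exact ⟨fun h => congrFun h 0, fun h => funext fun _ => h⟩

theorem ker_d (i : ℕ) : LinearMap.ker (F.d i) = LinearMap.range (F.d (i + 1)) :=
  (F.exact_succ i).linearMap_ker_eq

/-- The dimension shift iterated along the resolution: each step down trades one homological degree
for one coefficient degree. -/
theorem vanishes_range_d_iff (i : ℕ) (a p : ℤ) (ha : 0 ≤ a) :
    KoszulVanishes (subPart (F.shift i) (LinearMap.range (F.d i))) (polyVariables K n) a (p + i) ↔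
      KoszulVanishes (subPart (F.shift 0) (LinearMap.range (F.d 0))) (polyVariables K n)
        (a + i) p := by
  induction i generalizing a with
  | zero => simp
  | succ i ih =>
    have h := IsGradedMap.vanishes_range_iff (F.d_homogeneous i)
      ((F.ker_d i).trans_le (F.minimal (i + 1))) a (p + i) ha
    rw [ih (a + 1) (by omega), F.ker_d i] at h
    push_cast
    rw [← add_assoc, ← h, add_right_comm, add_assoc]

theorem betti_eq_zero_iff (i j : ℕ) : F.betti i j = 0 ↔ ∀ k, F.shift i k ≠ j := by
  rw [betti, Fintype.card_eq_zero_iff, isEmpty_subtype]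

/-- The right-hand side does not mention `F`, so the choice of resolution hidden in `gradedBetti`
does not matter. -/
theorem betti_eq_zero_iff_vanishes (i j : ℕ) (h : i = 0 → j ≠ 0) :
    F.betti i j = 0 ↔
      KoszulVanishes (quotPart I) (polyVariables K n) (i + 1) ((j : ℤ) - i - 1) := by
  have hmin : LinearMap.ker F.augmentation ≤ irrelevant K n • ⊤ :=
    F.ker_augmentation.trans_le (F.minimal 0)
  rw [vanishes_quotient_iff I (by omega), ← F.range_augmentation, betti_eq_zero_iff, sub_add_cancel]
  rcases i with _ | i
  · rw [Nat.cast_zero, sub_zero, F.isGradedMap_augmentation.vanishes_range_zero_iff hmin]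
    norm_cast
  · rw [Nat.cast_succ, F.isGradedMap_augmentation.vanishes_range_iff hmin _ _ (by omega),
      F.ker_augmentation]
    have h1 := F.vanishes_range_d_iff i 0 (j - i) le_rfl
    rw [zero_add (i : ℤ)] at h1
    rw [sub_add_eq_sub_sub, sub_add_cancel, ← h1, sub_add_cancel,
      IsGradedMap.vanishes_range_zero_iff (F.d_homogeneous i)
        ((F.ker_d i).trans_le (F.minimal (i + 1)))]
    norm_cast

end MinimalGradedFreeResolution

end Resolutions


/-! ### Existence of minimal graded free resolutions -/

section Existence

variable {K : Type*} [Field K] {n : ℕ}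

/-- A submodule of a free graded module that contains the homogeneous components of its elements. -/
def IsGradedSubmodule {r : ℕ} (s : Fin r → ℕ)
    (Z : Submodule (MvPolynomial (Fin n) K) (Fin r → MvPolynomial (Fin n) K)) : Prop :=
  ∀ v ∈ Z, ∀ T : Set ℕ, ∃ w ∈ degreesIn s T, ∃ w' ∈ degreesIn s Tᶜ, w + w' = v ∧ w ∈ Z

theorem IsGradedMap.isGradedSubmodule_ker {r r' : ℕ} {s : Fin r → ℕ} {s' : Fin r' → ℕ}
    {φ : (Fin r → MvPolynomial (Fin n) K) →ₗ[MvPolynomial (Fin n) K]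
      (Fin r' → MvPolynomial (Fin n) K)} (h : IsGradedMap s s' φ) :
    IsGradedSubmodule s (LinearMap.ker φ) := by
  intro v hv T
  obtain ⟨w, hw, w', hw', rfl⟩ := exists_degreesIn_split s T v
  refine ⟨w, hw, w', hw', rfl, eq_zero_of_mem_degreesIn (h.map_mem hw) ?_⟩
  rw [LinearMap.mem_ker, map_add] at hv
  rw [eq_neg_of_add_eq_zero_left hv]
  exact neg_mem (h.map_mem hw')

theorem exists_degree_bound {r : ℕ} (s : Fin r → ℕ) (v : Fin r → MvPolynomial (Fin n) K) :
    ∃ N, v ∈ degreesIn s (Set.Iio N) := by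
  refine ⟨∑ k, ((v k).totalDegree + s k + 1), fun k m hm => ?_⟩
  have h1 : m.degree ≤ (v k).totalDegree := le_totalDegree hm
  have h2 := Finset.single_le_sum (f := fun k => (v k).totalDegree + s k + 1)
    (fun _ _ => Nat.zero_le _) (Finset.mem_univ k)
  simp only [Set.mem_Iio] at h2 ⊢
  omega

theorem degreesIn_mono {r : ℕ} {s : Fin r → ℕ} {T T' : Set ℕ} (h : T ⊆ T') :
    (degreesIn s T : AddSubgroup (Fin r → MvPolynomial (Fin n) K)) ≤ degreesIn s T' :=
  fun _ hv k m hm => h (hv k m hm)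

theorem IsGradedSubmodule.span_homogeneous {r : ℕ} {s : Fin r → ℕ}
    {Z : Submodule (MvPolynomial (Fin n) K) (Fin r → MvPolynomial (Fin n) K)}
    (h : IsGradedSubmodule s Z) :
    Submodule.span (MvPolynomial (Fin n) K) {v | v ∈ Z ∧ ∃ p, v ∈ degreesIn s {p}} = Z := by
  refine le_antisymm (Submodule.span_le.2 fun v hv => hv.1) fun v hv => ?_
  obtain ⟨N, hN⟩ := exists_degree_bound s v
  induction N generalizing v with
  | zero =>
    rw [eq_zero_of_mem_degreesIn (T := ∅) (degreesIn_mono (by simp) hN)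
      (degreesIn_mono (by simp) hN)]
    exact zero_mem _
  | succ N ih =>
    obtain ⟨w, hw, w', hw', rfl, hwZ⟩ := h v hv {N}
    have hwZ' : w' ∈ Z := by simpa using sub_mem hv hwZ
    refine add_mem (Submodule.subset_span ⟨hwZ, N, hw⟩) (ih w' hwZ' fun k m hm => ?_)
    have h1 : w' ∈ degreesIn s (Set.Iio (N + 1)) := by
      have : w ∈ degreesIn s (Set.Iio (N + 1)) := degreesIn_mono (by simp) hw
      simpa using sub_mem hN this
    have h2 := h1 k m hm
    have h3 := hw' k m hm
    simp only [Set.mem_Iio, Set.mem_compl_iff, Set.mem_singleton_iff] at h2 h3 ⊢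
    omega

/-- `Z` is generated by `r'` homogeneous elements. -/
def HasHomogeneousGenerators {r : ℕ} (s : Fin r → ℕ)
    (Z : Submodule (MvPolynomial (Fin n) K) (Fin r → MvPolynomial (Fin n) K)) (r' : ℕ) : Prop :=
  ∃ (s' : Fin r' → ℕ) (g : Fin r' → Fin r → MvPolynomial (Fin n) K),
    (∀ k, g k ∈ degreesIn s {s' k}) ∧ Submodule.span _ (Set.range g) = Z

theorem IsGradedSubmodule.exists_hasHomogeneousGenerators {r : ℕ} {s : Fin r → ℕ}
    {Z : Submodule (MvPolynomial (Fin n) K) (Fin r → MvPolynomial (Fin n) K)}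
    (h : IsGradedSubmodule s Z) : ∃ r', HasHomogeneousGenerators s Z r' := by
  have hfg : Z.FG := IsNoetherian.noetherian Z
  rw [← h.span_homogeneous, Submodule.fg_span_iff_fg_span_finset_subset] at hfg
  obtain ⟨G, hG, e⟩ := hfg
  rw [h.span_homogeneous] at e
  choose s' hs' using fun k : G => (hG k.2).2
  refine ⟨G.card, fun k => s' (G.equivFin.symm k), fun k => G.equivFin.symm k, fun k => hs' _, ?_⟩
  rw [e]
  congr 1
  ext v
  constructor
  · rintro ⟨k, rfl⟩
    exact (G.equivFin.symm k).2
  · intro hv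
    exact ⟨G.equivFin ⟨v, hv⟩, by simp⟩

/-- A homogeneous generating set with the fewest elements works: a relation with a unit coefficient
would make one generator redundant. -/
theorem IsGradedSubmodule.exists_minimal_cover {r : ℕ} {s : Fin r → ℕ}
    {Z : Submodule (MvPolynomial (Fin n) K) (Fin r → MvPolynomial (Fin n) K)}
    (h : IsGradedSubmodule s Z) :
    ∃ (r' : ℕ) (s' : Fin r' → ℕ) (φ : (Fin r' → MvPolynomial (Fin n) K) →ₗ[MvPolynomial (Fin n) K]
      (Fin r → MvPolynomial (Fin n) K)), IsGradedMap s' s φ ∧ LinearMap.range φ = Z ∧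
        LinearMap.ker φ ≤ irrelevant K n • ⊤ := by
  classical
  have hex := h.exists_hasHomogeneousGenerators
  obtain ⟨s', g, hg, hspan⟩ := Nat.find_spec hex
  have hmin := fun {r'} => Nat.find_min hex (m := r')
  generalize Nat.find hex = r' at s' g hg hspan hmin
  have happ : ∀ k, Fintype.linearCombination (MvPolynomial (Fin n) K) g (Pi.single k 1) = g k := by
    intro k
    rw [Fintype.linearCombination_apply_single, one_smul]
  have hgr : IsGradedMap s' s (Fintype.linearCombination (MvPolynomial (Fin n) K) g) := by
    intro k l m hm
    rw [happ] at hm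
    exact hg l k m hm
  refine ⟨r', s', _, hgr, by rw [Fintype.range_linearCombination, hspan], fun v hv => ?_⟩
  rw [mem_irrelevant_smul_top]
  intro k
  by_contra hk
  -- Only the component in degree `s' k` is kept; there the `k`-th coefficient is a constant, hence
  -- a unit.
  obtain ⟨w, hw, w', hw', rfl, hwZ⟩ := hgr.isGradedSubmodule_ker v hv {s' k}
  have hw0 : coeff 0 (w' k) = 0 := by
    by_contra h0
    exact hw' k 0 (mem_support_iff.2 h0) (by simp)
  have hwk : w k = C (coeff 0 (w k)) := by
    ext m
    rw [coeff_C]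
    split_ifs with hm
    · rw [hm]
    · by_contra h0
      have := hw k m (mem_support_iff.2 h0)
      simp only [Set.mem_singleton_iff, Nat.add_eq_right, Finsupp.degree_eq_zero_iff] at this
      exact hm this.symm
  rw [Pi.add_apply, coeff_add, hw0, add_zero] at hk
  obtain _ | r' := r'
  · exact k.elim0
  refine hmin (Nat.lt_succ_self r') ⟨fun j => s' (k.succAbove j), fun j => g (k.succAbove j),
    fun j => hg _, le_antisymm ?_ ?_⟩
  · rw [← hspan]
    exact Submodule.span_mono (Set.range_comp_subset_range k.succAbove g)
  · rw [← hspan, Submodule.span_le]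
    have hmem : ∀ j, g (k.succAbove j) ∈ Submodule.span (MvPolynomial (Fin n) K)
        (Set.range fun j => g (k.succAbove j)) := fun j => Submodule.subset_span ⟨j, rfl⟩
    rintro _ ⟨j, rfl⟩
    induction j using Fin.succAboveCases k with
    | x =>
      rw [LinearMap.mem_ker, Fintype.linearCombination_apply, Fin.sum_univ_succAbove _ k, hwk] at hwZ
      have h1 : (C (coeff 0 (w k))⁻¹ : MvPolynomial (Fin n) K) •
        (C (coeff 0 (w k)) : MvPolynomial (Fin n) K) • g k = g k := by
        rw [smul_smul, ← C_mul, inv_mul_cancel₀ hk, C_1, one_smul]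
      rw [SetLike.mem_coe, ← h1, eq_neg_of_add_eq_zero_left hwZ]
      exact Submodule.smul_mem _ _ (neg_mem (sum_mem fun j _ => Submodule.smul_mem _ _ (hmem j)))
    | p j => exact hmem j

variable (K n) in
/-- A free graded module with a graded submodule. -/
structure ResolutionStage where
  /-- the rank of the free module -/
  rank : ℕ
  /-- the degrees of its basis -/
  shift : Fin rank → ℕ
  /-- the submodule -/
  carrier : Submodule (MvPolynomial (Fin n) K) (Fin rank → MvPolynomial (Fin n) K)
  isGraded : IsGradedSubmodule shift carrier

namespace ResolutionStage

variable (Z : ResolutionStage K n)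

/-- The rank of a minimal free cover. -/
def coverRank : ℕ := Z.isGraded.exists_minimal_cover.choose

/-- The shifts of a minimal free cover. -/
def coverShift : Fin Z.coverRank → ℕ := Z.isGraded.exists_minimal_cover.choose_spec.choose

/-- A minimal free cover. -/
def cover : (Fin Z.coverRank → MvPolynomial (Fin n) K) →ₗ[MvPolynomial (Fin n) K]
    (Fin Z.rank → MvPolynomial (Fin n) K) :=
  Z.isGraded.exists_minimal_cover.choose_spec.choose_spec.choose

theorem cover_spec : IsGradedMap Z.coverShift Z.shift Z.cover ∧ LinearMap.range Z.cover = Z.carrier ∧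
    LinearMap.ker Z.cover ≤ irrelevant K n • ⊤ :=
  Z.isGraded.exists_minimal_cover.choose_spec.choose_spec.choose_spec

/-- The kernel of a minimal free cover. -/
def next : ResolutionStage K n :=
  ⟨Z.coverRank, Z.coverShift, LinearMap.ker Z.cover, Z.cover_spec.1.isGradedSubmodule_ker⟩

/-- The iterated syzygies. -/
def iterate : ℕ → ResolutionStage K n
  | 0 => Z
  | i + 1 => (iterate i).next

end ResolutionStage

theorem range_proj_comp {r : ℕ} {I : Ideal (MvPolynomial (Fin n) K)}
    {φ : (Fin r → MvPolynomial (Fin n) K) →ₗ[MvPolynomial (Fin n) K]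
      (Fin 1 → MvPolynomial (Fin n) K)} (h : LinearMap.range φ = idealSubmodule I) :
    LinearMap.range (LinearMap.proj 0 ∘ₗ φ) = I := by
  rw [LinearMap.range_comp, h]
  exact Submodule.map_comap_eq_of_surjective (fun f => ⟨fun _ => f, rfl⟩) I

theorem exact_proj_comp {r r' : ℕ}
    {φ : (Fin r → MvPolynomial (Fin n) K) →ₗ[MvPolynomial (Fin n) K]
      (Fin 1 → MvPolynomial (Fin n) K)}
    {ψ : (Fin r' → MvPolynomial (Fin n) K) →ₗ[MvPolynomial (Fin n) K]
      (Fin r → MvPolynomial (Fin n) K)} (h : LinearMap.range ψ = LinearMap.ker φ) :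
    Function.Exact ψ (LinearMap.proj 0 ∘ₗ φ) := by
  rw [LinearMap.exact_iff, h]
  ext v
  rw [LinearMap.mem_ker, LinearMap.mem_ker]
  exact ⟨fun h => funext fun k => by rw [Subsingleton.elim k 0]; exact h, fun h => congrFun h 0⟩

theorem IsGradedMap.isHomogeneous_proj_comp {r : ℕ} {s : Fin r → ℕ}
    {φ : (Fin r → MvPolynomial (Fin n) K) →ₗ[MvPolynomial (Fin n) K]
      (Fin 1 → MvPolynomial (Fin n) K)} (h : IsGradedMap s (fun _ => 0) φ) (k : Fin r) :
    ((LinearMap.proj 0 ∘ₗ φ) (Pi.single k 1) : MvPolynomial (Fin n) K).IsHomogeneous (s k) := by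
  intro m hm
  have := h 0 k m (mem_support_iff.2 hm)
  rw [add_zero, Finsupp.degree_eq_weight_one] at this
  exact this

theorem nonempty_minimalGradedFreeResolution (I : Ideal (MvPolynomial (Fin n) K))
    (hI : IsGradedSubmodule (fun _ => 0) (idealSubmodule I)) :
    Nonempty (MinimalGradedFreeResolution I) := by
  let Z : ResolutionStage K n := ⟨1, fun _ => 0, idealSubmodule I, hI⟩
  have hrange : ∀ i, LinearMap.range (Z.iterate (i + 1)).cover = LinearMap.ker (Z.iterate i).cover :=
    fun i => (Z.iterate (i + 1)).cover_spec.2.1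
  have hexact : ∀ i, Function.Exact (Z.iterate (i + 1)).cover (Z.iterate i).cover :=
    fun i => LinearMap.exact_iff.2 (hrange i).symm
  exact ⟨{
    rank := fun i => (Z.iterate (i + 1)).rank
    shift := fun i => (Z.iterate (i + 1)).shift
    d := fun i => (Z.iterate (i + 1)).cover
    ε := LinearMap.proj (0 : Fin 1) ∘ₗ Z.cover
    d_homogeneous := fun i => (Z.iterate (i + 1)).cover_spec.1
    ε_homogeneous := Z.cover_spec.1.isHomogeneous_proj_comp
    range_ε := range_proj_comp Z.cover_spec.2.1
    exact_zero := exact_proj_comp (hrange 0)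
    exact_succ := fun i => hexact (i + 1)
    minimal := fun i => (hrange i).trans_le (Z.iterate i).cover_spec.2.2 }⟩

end Existence


/-! ### Regularity bounds for squarefree monomial ideals -/

section SquarefreeIdeals

variable {K : Type*} [Field K] {n : ℕ}

/-- The exponent of the squarefree monomial with support `A`. -/
def squarefreeExponent (A : Finset (Fin n)) : Fin n →₀ ℕ := ∑ i ∈ A, Finsupp.single i 1

theorem squarefreeExponent_apply (A : Finset (Fin n)) (i : Fin n) :
    squarefreeExponent A i = if i ∈ A then 1 else 0 := by
  simp [squarefreeExponent, Finsupp.finsetSum_apply, Finsupp.single_apply]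

theorem squarefreeExponent_le_iff {A : Finset (Fin n)} {m : Fin n →₀ ℕ} :
    squarefreeExponent A ≤ m ↔ A ⊆ m.support := by
  constructor
  · intro h i hi
    have := h i
    rw [squarefreeExponent_apply, if_pos hi] at this
    exact Finsupp.mem_support_iff.2 (by omega)
  · intro h i
    rw [squarefreeExponent_apply]
    split_ifs with hi
    · exact Nat.one_le_iff_ne_zero.2 (Finsupp.mem_support_iff.1 (h hi))
    · exact Nat.zero_le _

theorem degree_squarefreeExponent (A : Finset (Fin n)) : (squarefreeExponent A).degree = A.card := by
  simp [squarefreeExponent]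

theorem monomial_squarefreeExponent (A : Finset (Fin n)) :
    monomial (squarefreeExponent A) (1 : K) = ∏ i ∈ A, X i :=
  monomial_sum_one _ _

variable (K) in
/-- The ideal generated by the squarefree monomials with supports in `𝓕`. -/
def squarefreeIdeal (𝓕 : Set (Finset (Fin n))) : Ideal (MvPolynomial (Fin n) K) :=
  Ideal.span ((fun A => ∏ i ∈ A, X i) '' 𝓕)

theorem mem_squarefreeIdeal {𝓕 : Set (Finset (Fin n))} {f : MvPolynomial (Fin n) K} :
    f ∈ squarefreeIdeal K 𝓕 ↔ ∀ m ∈ f.support, ∃ A ∈ 𝓕, A ⊆ m.support := by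
  have e : (fun A : Finset (Fin n) => (∏ i ∈ A, X i : MvPolynomial (Fin n) K)) '' 𝓕 =
      (fun s => monomial s (1 : K)) '' (squarefreeExponent '' 𝓕) := by
    rw [Set.image_image]
    simp only [monomial_squarefreeExponent]
  rw [squarefreeIdeal, e, mem_ideal_span_monomial_image]
  simp only [Set.exists_mem_image, squarefreeExponent_le_iff]

theorem isGradedSubmodule_squarefreeIdeal (𝓕 : Set (Finset (Fin n))) :
    IsGradedSubmodule (fun _ => 0) (idealSubmodule (squarefreeIdeal K 𝓕)) := by
  intro v hv T
  have hv' : v 0 ∈ squarefreeIdeal K 𝓕 := hv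
  obtain ⟨g, h, hg, hh, e⟩ := exists_polynomial_split (fun m => m.degree ∈ T) (v 0)
  refine ⟨fun _ => g, fun _ => hg, fun _ => h, fun _ => hh, ?_, ?_⟩
  · funext k
    rw [Subsingleton.elim k 0]
    exact e
  · refine mem_squarefreeIdeal.2 fun m hm => mem_squarefreeIdeal.1 hv' m ?_
    have h0 : coeff m h = 0 := by
      by_contra h0
      exact hh m (mem_support_iff.2 h0) (hg m hm)
    rw [← e, mem_support_iff, coeff_add, h0, add_zero]
    exact mem_support_iff.1 hm

theorem mem_quotPart {I : Ideal (MvPolynomial (Fin n) K)} {p : ℤ} {c : MvPolynomial (Fin n) K ⧸ I} :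
    c ∈ quotPart I p ↔ ∃ f : MvPolynomial (Fin n) K, (∀ m ∈ f.support, (m.degree : ℤ) = p) ∧
      I.mkQ f = c := by
  constructor
  · rintro ⟨v, hv, rfl⟩
    exact ⟨v 0, hv 0, rfl⟩
  · rintro ⟨f, hf, rfl⟩
    exact ⟨fun _ => f, fun _ => hf, rfl⟩

theorem raisesDegree_quotPart (I : Ideal (MvPolynomial (Fin n) K)) :
    RaisesDegree (quotPart I) (polyVariables K n) := by
  rintro x hx p _ ⟨v, hv, rfl⟩
  exact ⟨x • v, raisesDegree_free _ x hx p v hv, rfl⟩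

theorem mem_support_prod_mul {B : Finset (Fin n)} {f : MvPolynomial (Fin n) K} {m : Fin n →₀ ℕ} :
    m ∈ ((∏ i ∈ B, X i) * f).support ↔ ∃ m' ∈ f.support, squarefreeExponent B + m' = m := by
  rw [← monomial_squarefreeExponent, mem_support_iff, coeff_monomial_mul']
  constructor
  · intro h
    split_ifs at h with hB
    · exact ⟨m - squarefreeExponent B, mem_support_iff.2 (by simpa using h),
        add_tsub_cancel_of_le hB⟩
    · exact absurd rfl h
  · rintro ⟨m', hm', rfl⟩
    rw [if_pos le_self_add, one_mul, add_tsub_cancel_left]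
    exact mem_support_iff.1 hm'

theorem support_squarefreeExponent_add (B : Finset (Fin n)) (m : Fin n →₀ ℕ) :
    (squarefreeExponent B + m).support = B ∪ m.support := by
  ext i
  simp only [Finsupp.mem_support_iff, Finsupp.add_apply, squarefreeExponent_apply,
    Finset.mem_union]
  split_ifs with h <;> simp [h]

/-- The colon ideal by the monomial of `B` is obtained by deleting `B` from every member of the
family. -/
theorem prod_mul_mem_squarefreeIdeal_iff {𝓕 : Set (Finset (Fin n))} {B : Finset (Fin n)}
    {f : MvPolynomial (Fin n) K} :
    (∏ i ∈ B, X i) * f ∈ squarefreeIdeal K 𝓕 ↔ f ∈ squarefreeIdeal K ((· \ B) '' 𝓕) := by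
  have key : ∀ A C : Finset (Fin n), A \ B ⊆ C ↔ A ⊆ B ∪ C := fun _ _ => sdiff_le_iff
  simp only [mem_squarefreeIdeal, Set.exists_mem_image, key]
  constructor
  · intro h m hm
    simpa [support_squarefreeExponent_add] using
      h (squarefreeExponent B + m) (mem_support_prod_mul.2 ⟨m, hm, rfl⟩)
  · intro h m hm
    obtain ⟨m', hm', rfl⟩ := mem_support_prod_mul.1 hm
    simpa [support_squarefreeExponent_add] using h m' hm'

theorem squarefreeIdeal_mono {𝓕 𝓖 : Set (Finset (Fin n))} (h : 𝓕 ⊆ 𝓖) :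
    squarefreeIdeal K 𝓕 ≤ squarefreeIdeal K 𝓖 :=
  Ideal.span_mono (Set.image_mono h)

theorem squarefreeIdeal_colon_le (𝓕 : Set (Finset (Fin n))) (B : Finset (Fin n)) :
    squarefreeIdeal K ((· \ B) '' 𝓕) ≤ Submodule.comap
      (LinearMap.mulLeft (MvPolynomial (Fin n) K) (∏ i ∈ B, X i)) (squarefreeIdeal K 𝓕) :=
  fun _ hf => prod_mul_mem_squarefreeIdeal_iff.2 hf

/-- The sequence `0 → S/(I : u)(-e) → S/I → S/(I + (u)) → 0` for a squarefree monomial ideal `I`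
and a squarefree monomial `u` of degree `e`. -/
theorem gradedShortExact_colon (𝓕 : Set (Finset (Fin n))) (B : Finset (Fin n)) :
    GradedShortExact (fun p => quotPart (squarefreeIdeal K ((· \ B) '' 𝓕)) (p - B.card))
      (quotPart (squarefreeIdeal K 𝓕)) (quotPart (squarefreeIdeal K (insert B 𝓕)))
      (Submodule.mapQ _ _ (LinearMap.mulLeft (MvPolynomial (Fin n) K) (∏ i ∈ B, X i))
        (squarefreeIdeal_colon_le 𝓕 B))
      (Submodule.factor (squarefreeIdeal_mono (Set.subset_insert B 𝓕))) where
  injective a ha := by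
    obtain ⟨a, rfl⟩ := Submodule.mkQ_surjective _ a
    exact (Submodule.Quotient.mk_eq_zero _).2
      (prod_mul_mem_squarefreeIdeal_iff.1 ((Submodule.Quotient.mk_eq_zero _).1 ha))
  map_left p a ha := by
    obtain ⟨f, hf, rfl⟩ := mem_quotPart.1 ha
    refine mem_quotPart.2 ⟨(∏ i ∈ B, X i) * f, fun m hm => ?_, rfl⟩
    obtain ⟨m', hm', rfl⟩ := mem_support_prod_mul.1 hm
    have := hf m' hm'
    rw [map_add, degree_squarefreeExponent]
    push_cast
    omega
  map_right p b hb := by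
    obtain ⟨f, hf, rfl⟩ := mem_quotPart.1 hb
    exact mem_quotPart.2 ⟨f, hf, rfl⟩
  comp_eq_zero a := by
    obtain ⟨a, rfl⟩ := Submodule.mkQ_surjective _ a
    refine (Submodule.Quotient.mk_eq_zero _).2 ?_
    exact Ideal.mul_mem_right _ _ (Ideal.subset_span ⟨B, Set.mem_insert B 𝓕, rfl⟩)
  surjective p c hc := by
    obtain ⟨f, hf, rfl⟩ := mem_quotPart.1 hc
    exact ⟨_, mem_quotPart.2 ⟨f, hf, rfl⟩, rfl⟩
  exact p b hb h0 := by
    obtain ⟨f, hf, rfl⟩ := mem_quotPart.1 hb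
    have hf0 : f ∈ squarefreeIdeal K (insert B 𝓕) := (Submodule.Quotient.mk_eq_zero _).1 h0
    -- The preimage is the quotient of `f` on division by the monomial of `B`. No term of the
    -- remainder is divisible by that monomial, so each is divisible by a generator from `𝓕`.
    refine ⟨_, mem_quotPart.2 ⟨f.divMonomial (squarefreeExponent B), fun m hm => ?_, rfl⟩, ?_⟩
    · rw [mem_support_iff, coeff_divMonomial, ← mem_support_iff] at hm
      have := hf _ hm
      rw [map_add, degree_squarefreeExponent] at this
      push_cast at this
      omega
    · refine ((Submodule.Quotient.eq _).2 ?_).symm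
      rw [LinearMap.mulLeft_apply, ← monomial_squarefreeExponent]
      have e := divMonomial_add_modMonomial f (squarefreeExponent B)
      rw [sub_eq_of_eq_add' e.symm, mem_squarefreeIdeal]
      intro m hm
      have hB : ¬ squarefreeExponent B ≤ m := fun hB =>
        mem_support_iff.1 hm (coeff_modMonomial_of_le _ hB)
      rw [mem_support_iff, coeff_modMonomial_of_not_le _ hB, ← mem_support_iff] at hm
      obtain ⟨A, hA, hAm⟩ := mem_squarefreeIdeal.1 hf0 m hm
      rcases hA with rfl | hA
      · exact absurd (squarefreeExponent_le_iff.2 hAm) hB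
      · exact ⟨A, hA, hAm⟩

/-- The Castelnuovo–Mumford regularity of `S / I` is at most `r`. -/
def RegularityLE (I : Ideal (MvPolynomial (Fin n) K)) (r : ℤ) : Prop :=
  ∀ i p, r < p → KoszulVanishes (quotPart I) (polyVariables K n) i p

theorem RegularityLE.mono {I : Ideal (MvPolynomial (Fin n) K)} {r r' : ℤ} (h : RegularityLE I r)
    (hr : r ≤ r') : RegularityLE I r' := fun i p hp => h i p (hr.trans_lt hp)

theorem regularityLE_top (r : ℤ) : RegularityLE (⊤ : Ideal (MvPolynomial (Fin n) K)) r := by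
  intro i p _
  refine koszulVanishes_of_eq_bot ?_ _ i
  have : Subsingleton (MvPolynomial (Fin n) K ⧸ (⊤ : Ideal (MvPolynomial (Fin n) K))) :=
    Ideal.Quotient.subsingleton_iff.2 rfl
  exact Subsingleton.elim _ _

theorem regularityLE_bot : RegularityLE (⊥ : Ideal (MvPolynomial (Fin n) K)) 0 := by
  intro i p hp
  refine (gradedShortExact_quotient ⊥).vanishes_right (raisesDegree_free _) ?_
    (koszulVanishes_of_eq_bot ?_ _ _)
  · rcases lt_trichotomy i 0 with hi | rfl | hi
    · exact koszulVanishes_of_neg _ _ hi p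
    · refine koszulVanishes_free_zero fun _ => ?_
      simp only [Nat.cast_zero]
      omega
    · exact koszulVanishes_free _ i p hi
  · rw [eq_bot_iff]
    intro v _
    refine Subtype.ext (funext fun k => ?_)
    rw [Subsingleton.elim k 0]
    exact v.2

theorem squarefreeIdeal_eq_top {𝓕 : Set (Finset (Fin n))} (h : ∅ ∈ 𝓕) :
    squarefreeIdeal K 𝓕 = ⊤ :=
  (Ideal.eq_top_iff_one _).2 (Ideal.subset_span ⟨∅, h, by simp⟩)

theorem regularityLE_of_colon {𝓕 : Set (Finset (Fin n))} {r : ℤ} (k : Fin n)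
    (h : RegularityLE (squarefreeIdeal K ((· \ {k}) '' 𝓕)) (r - 1))
    (h' : RegularityLE (squarefreeIdeal K (insert {k} 𝓕)) r) :
    RegularityLE (squarefreeIdeal K 𝓕) r := by
  intro i p hp
  refine (gradedShortExact_colon 𝓕 {k}).vanishes_middle (raisesDegree_quotPart _) ?_ (h' i p hp)
  rw [koszulVanishes_shift]
  refine h i _ ?_
  rw [Finset.card_singleton]
  push_cast
  omega

theorem image_sdiff_eq_self {𝓕 : Set (Finset (Fin n))} {B : Finset (Fin n)}
    (hB : ∀ A ∈ 𝓕, Disjoint A B) : (· \ B) '' 𝓕 = 𝓕 := by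
  refine (Set.image_congr fun A hA => ?_).trans (Set.image_id 𝓕)
  exact Finset.sdiff_eq_self_of_disjoint (hB A hA)

/-- A monomial with support disjoint from all generators is a nonzerodivisor on the quotient;
dividing by it raises the bound by its degree minus one. -/
theorem RegularityLE.insert {𝓕 : Set (Finset (Fin n))} {r : ℤ}
    (h : RegularityLE (squarefreeIdeal K 𝓕) r) {B : Finset (Fin n)} (hB : ∀ A ∈ 𝓕, Disjoint A B)
    (hne : B.Nonempty) : RegularityLE (squarefreeIdeal K (insert B 𝓕)) (r + B.card - 1) := by
  intro i p hp
  have := hne.card_pos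
  refine (gradedShortExact_colon 𝓕 B).vanishes_right (raisesDegree_quotPart _)
    (h i p (by omega)) ?_
  rw [koszulVanishes_shift, image_sdiff_eq_self hB]
  exact h _ _ (by omega)

theorem regularityLE_singletons (E : Finset (Fin n)) :
    RegularityLE (squarefreeIdeal K ((fun k => {k}) '' (E : Set (Fin n)))) 0 := by
  induction E using Finset.induction_on with
  | empty =>
    have : squarefreeIdeal K ((fun k : Fin n => ({k} : Finset (Fin n))) ''
        ((∅ : Finset (Fin n)) : Set (Fin n))) = ⊥ := by
      simp [squarefreeIdeal]
    rw [this]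
    exact regularityLE_bot
  | insert k E hk ih =>
    rw [Finset.coe_insert, Set.image_insert_eq]
    refine (ih.insert (B := {k}) ?_ (Finset.singleton_nonempty k)).mono (by simp)
    rintro _ ⟨j, hj, rfl⟩
    rw [Finset.disjoint_singleton]
    rintro rfl
    exact hk hj

theorem regularityLE_of_forall_singleton {𝓕 : Set (Finset (Fin n))}
    (h : ∀ A ∈ 𝓕, ∃ k ∈ A, {k} ∈ 𝓕) : RegularityLE (squarefreeIdeal K 𝓕) 0 := by
  classical
  have e : squarefreeIdeal K 𝓕 = squarefreeIdeal K
      ((fun k => {k}) '' ((Finset.univ.filter fun k => {k} ∈ 𝓕 : Finset (Fin n)) : Set (Fin n))) := by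
    apply le_antisymm
    · intro f hf
      rw [mem_squarefreeIdeal] at hf ⊢
      intro m hm
      obtain ⟨A, hA, hAm⟩ := hf m hm
      obtain ⟨k, hk, hk'⟩ := h A hA
      exact ⟨{k}, ⟨k, by simpa using hk', rfl⟩, by simpa using hAm hk⟩
    · apply squarefreeIdeal_mono
      rintro _ ⟨k, hk, rfl⟩
      simpa using hk
  rw [e]
  exact regularityLE_singletons _

/-- Every member of `𝓕` lies in `V` or contains a point outside `V` that is a member of `𝓕`. -/
def IsReducedTo (𝓕 : Set (Finset (Fin n))) (V : Finset (Fin n)) : Prop :=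
  ∀ A ∈ 𝓕, A ⊆ V ∨ ∃ k ∈ A, k ∉ V ∧ {k} ∈ 𝓕

/-- `IsReducedTo` lets the inductions count only the variables in `V` while staying in the same
ring: members not inside `V` are redundant next to a variable in the ideal. Both outer terms of the
colon sequence at `k` remove `k` from `V`. -/
theorem IsReducedTo.colon {𝓕 : Set (Finset (Fin n))} {V : Finset (Fin n)} (h : IsReducedTo 𝓕 V)
    {k : Fin n} (hk : k ∈ V) : IsReducedTo ((· \ {k}) '' 𝓕) (V.erase k) := by
  rintro _ ⟨A, hA, rfl⟩
  rcases h A hA with h | ⟨j, hj, hjV, hj'⟩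
  · left
    intro i hi
    simp only [Finset.mem_sdiff, Finset.mem_singleton] at hi
    exact Finset.mem_erase.2 ⟨hi.2, h hi.1⟩
  · have hjk : j ≠ k := fun e => hjV (e ▸ hk)
    refine Or.inr ⟨j, by simp [hj, hjk], fun h => hjV (Finset.mem_of_mem_erase h), {j}, hj', ?_⟩
    exact Finset.sdiff_eq_self_of_disjoint (Finset.disjoint_singleton.2 hjk)

theorem IsReducedTo.insert {𝓕 : Set (Finset (Fin n))} {V : Finset (Fin n)} (h : IsReducedTo 𝓕 V)
    (k : Fin n) : IsReducedTo (insert {k} 𝓕) (V.erase k) := by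
  have key : ∀ A : Finset (Fin n), k ∈ A → ∃ j ∈ A, j ∉ V.erase k ∧ {j} ∈ Insert.insert {k} 𝓕 :=
    fun A hk => ⟨k, hk, Finset.notMem_erase k V, Set.mem_insert _ _⟩
  rintro A (rfl | hA)
  · exact Or.inr (key _ (Finset.mem_singleton_self k))
  · by_cases hk : k ∈ A
    · exact Or.inr (key A hk)
    · rcases h A hA with h | ⟨j, hj, hjV, hj'⟩
      · exact Or.inl (Finset.subset_erase.2 ⟨h, hk⟩)
      · exact Or.inr ⟨j, hj, fun h => hjV (Finset.mem_of_mem_erase h), Set.mem_insert_of_mem _ hj'⟩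

/-- The hypothesis `hr` is `r ≥ |V| - ⌈|V|/d⌉` without the ceiling. Taking colons by the variables
of one generator in turn ends at the unit ideal; the side branches, where a variable is added, have
fewer variables left. -/
theorem regularityLE_of_degree_le (d : ℕ) (𝓕 : Set (Finset (Fin n))) (V : Finset (Fin n))
    (hV : IsReducedTo 𝓕 V) (hd0 : 1 ≤ d) (hd : ∀ A ∈ 𝓕, A ⊆ V → A.card ≤ d) (r : ℤ)
    (hr : (d : ℤ) * (V.card - r - 1) < V.card) : RegularityLE (squarefreeIdeal K 𝓕) r := by
  induction hv : V.card using Nat.strong_induction_on generalizing V 𝓕 r with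
  | _ v ih =>
  -- Here `e` is the number of variables of the chosen generator still to be divided out. A colon
  -- step lowers `|W|`, `q` and `e` by one each, which preserves the inequality; when a variable is
  -- added, the inequality implies the one required by `ih`.
  have inner : ∀ (e : ℕ) (𝓖 : Set (Finset (Fin n))) (W A : Finset (Fin n)) (q : ℤ), W.card ≤ v →
      IsReducedTo 𝓖 W → (∀ A ∈ 𝓖, A ⊆ W → A.card ≤ d) → A ∈ 𝓖 → A ⊆ W → A.card = e →
      (d : ℤ) * (W.card - q - 2) < W.card - e → RegularityLE (squarefreeIdeal K 𝓖) q := by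
    intro e
    induction e with
    | zero =>
      intro 𝓖 W A q _ _ _ hA _ hAe _
      rw [Finset.card_eq_zero] at hAe
      rw [squarefreeIdeal_eq_top (hAe ▸ hA)]
      exact regularityLE_top q
    | succ e ihe =>
      intro 𝓖 W A q hWv hW hWd hA hAW hAe hq
      obtain ⟨k, hk⟩ : A.Nonempty := Finset.card_pos.1 (by omega)
      have hkW := hAW hk
      have hcard := Finset.card_erase_add_one hkW
      have hcast : ((W.erase k).card : ℤ) = W.card - 1 := by omega
      refine regularityLE_of_colon k ?_ ?_
      · refine ihe _ (W.erase k) (A \ {k}) (q - 1) (by omega) (hW.colon hkW) ?_ ⟨A, hA, rfl⟩ ?_ ?_ ?_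
        · rintro _ ⟨B, hB, rfl⟩ hBW
          rcases hW B hB with h | ⟨j, hj, hjW, -⟩
          · exact (Finset.card_le_card Finset.sdiff_subset).trans (hWd B hB h)
          · refine absurd (Finset.mem_of_mem_erase (hBW ?_)) hjW
            have hjk : j ≠ k := fun e => hjW (e ▸ hkW)
            simp [hj, hjk]
        · rw [Finset.sdiff_singleton_eq_erase]
          exact Finset.erase_subset_erase k hAW
        · rw [Finset.sdiff_singleton_eq_erase, Finset.card_erase_of_mem hk, hAe]
          rfl
        · rw [hcast]
          push_cast at hq
          have : (W.card : ℤ) - 1 - (q - 1) - 2 = W.card - q - 2 := by ring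
          rw [this]
          omega
      · refine ih (W.erase k).card (by omega) _ (W.erase k) (hW.insert k) ?_ q ?_ rfl
        · rintro B (rfl | hB) hBW
          · exact absurd (hBW (Finset.mem_singleton_self k)) (Finset.notMem_erase k W)
          · exact hWd B hB (hBW.trans (Finset.erase_subset k W))
        · rw [hcast]
          push_cast at hq
          have : (W.card : ℤ) - 1 - q - 1 = W.card - q - 2 := by ring
          rw [this]
          omega
  by_cases hex : ∃ A ∈ 𝓕, A ⊆ V
  · obtain ⟨A, hA, hAV⟩ := hex
    refine inner A.card 𝓕 V A r hv.le hV hd hA hAV rfl ?_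
    have h1 : (A.card : ℤ) ≤ d := by exact_mod_cast hd A hA hAV
    have h2 : (d : ℤ) * (V.card - r - 2) = d * (V.card - r - 1) - d := by ring
    omega
  · push Not at hex
    -- A negative `r` would give `d (|V| - r - 1) ≥ d |V| ≥ |V|`, against `hr`.
    have hr0 : 0 ≤ r := by
      by_contra! h
      have h1 : (1 : ℤ) ≤ d := by exact_mod_cast hd0
      nlinarith
    refine (regularityLE_of_forall_singleton fun A hA => ?_).mono hr0
    rcases hV A hA with h | ⟨k, hk, -, hk'⟩
    · exact absurd h (hex A hA)
    · exact ⟨k, hk, hk'⟩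

/-- Each variable outside `W` costs at most one by the colon sequence. Once `V = W`, the ideal is
the unit ideal or is generated by variables. -/
theorem regularityLE_of_card_inter_le_one (W : Finset (Fin n)) (𝓕 : Set (Finset (Fin n)))
    (V : Finset (Fin n)) (hV : IsReducedTo 𝓕 V) (hWV : W ⊆ V)
    (hW : ∀ A ∈ 𝓕, A ⊆ V → (A ∩ W).card ≤ 1) :
    RegularityLE (squarefreeIdeal K 𝓕) (V.card - W.card) := by
  induction hv : V.card using Nat.strong_induction_on generalizing V 𝓕 with
  | _ v ih =>
  by_cases hVW : V ⊆ W
  · obtain rfl := hVW.antisymm hWV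
    rw [hv, sub_self]
    by_cases hempty : ∅ ∈ 𝓕
    · rw [squarefreeIdeal_eq_top hempty]
      exact regularityLE_top 0
    · refine regularityLE_of_forall_singleton fun A hA => ?_
      rcases hV A hA with h | ⟨k, hk, -, hk'⟩
      · have h1 := hW A hA h
        rw [Finset.inter_eq_left.2 h] at h1
        have h2 : A.Nonempty := Finset.nonempty_iff_ne_empty.2 fun e => hempty (e ▸ hA)
        obtain ⟨k, rfl⟩ := Finset.card_eq_one.1 (le_antisymm h1 h2.card_pos)
        exact ⟨k, Finset.mem_singleton_self k, hA⟩
      · exact ⟨k, hk, hk'⟩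
  · obtain ⟨k, hkV, hkW⟩ := Finset.not_subset.1 hVW
    have hcard := Finset.card_erase_add_one hkV
    have hWV' : W ⊆ V.erase k := Finset.subset_erase.2 ⟨hWV, hkW⟩
    have hcast : ((V.erase k).card : ℤ) = v - 1 := by omega
    refine regularityLE_of_colon k ?_ ?_
    · rw [sub_right_comm, ← hcast]
      refine ih _ (by omega) _ _ (hV.colon hkV) hWV' ?_ rfl
      rintro _ ⟨A, hA, rfl⟩ hAV
      refine (Finset.card_le_card (Finset.inter_subset_inter_right Finset.sdiff_subset)).trans ?_
      rcases hV A hA with h | ⟨j, hj, hjV, -⟩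
      · exact hW A hA h
      · refine absurd (Finset.mem_of_mem_erase (hAV ?_)) hjV
        have hjk : j ≠ k := fun e => hjV (e ▸ hkV)
        simp [hj, hjk]
    · refine (ih _ (by omega) _ _ (hV.insert k) hWV' ?_ rfl).mono (by omega)
      rintro A (rfl | hA) hAV
      · exact absurd (hAV (Finset.mem_singleton_self k)) (Finset.notMem_erase k V)
      · exact hW A hA (hAV.trans (Finset.erase_subset k V))

end SquarefreeIdeals


/-! ### From Koszul vanishing to the theorem: `t`-spread and Pascal ideals -/

section Bounds

variable {K : Type*} [Field K] {n : ℕ}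

/-- The bound `-1 ≤ r` disposes of the exceptional pair `(i, j) = (0, 0)`. -/
theorem le_of_gradedBetti_ne_zero {I : Ideal (MvPolynomial (Fin n) K)} {r : ℤ} (hr : -1 ≤ r)
    (h : RegularityLE I r) {i j : ℕ} (hij : gradedBetti I i j ≠ 0) : (j : ℤ) - i ≤ r + 1 := by
  by_contra! hlt
  apply hij
  rw [gradedBetti]
  split_ifs with hF
  · exact (hF.some.betti_eq_zero_iff_vanishes i j (by omega)).2 (h _ _ (by omega))
  · rfl

theorem regularity_le {I : Ideal (MvPolynomial (Fin n) K)} {r : ℤ} (hr : -1 ≤ r)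
    (h : RegularityLE I r) : regularity I ≤ ((r + 1 : ℤ) : WithTop ℤ) := by
  refine sSup_le ?_
  rintro _ ⟨i, j, hij, rfl⟩
  rw [WithBot.coe_le_coe, WithTop.coe_le_coe]
  exact le_of_gradedBetti_ne_zero hr h hij

theorem le_regularity {I : Ideal (MvPolynomial (Fin n) K)}
    (hI : Nonempty (MinimalGradedFreeResolution I)) {i j : ℕ} (hij : i = 0 → j ≠ 0)
    (h : ¬ KoszulVanishes (quotPart I) (polyVariables K n) (i + 1) ((j : ℤ) - i - 1)) :
    (((j : ℤ) - i : ℤ) : WithTop ℤ) ≤ regularity I := by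
  refine le_sSup ⟨i, j, ?_, rfl⟩
  rw [gradedBetti, dif_pos hI]
  exact fun h0 => h ((hI.some.betti_eq_zero_iff_vanishes i j hij).1 h0)

theorem not_koszulVanishes_bot :
    ¬ KoszulVanishes (quotPart (⊥ : Ideal (MvPolynomial (Fin n) K))) (polyVariables K n) 0 0 := by
  intro h
  have h1 : Submodule.mkQ (⊥ : Ideal (MvPolynomial (Fin n) K)) 1 ∈ quotPart ⊥ 0 := by
    refine mem_quotPart.2 ⟨1, fun m hm => ?_, rfl⟩
    rw [← C_1, mem_support_iff, coeff_C] at hm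
    have : 0 = m := by
      by_contra h0
      exact hm (if_neg h0)
    simp [← this]
  obtain ⟨b, hb, e⟩ := h _ (koszulInl_mem _ _ _ _ h1) (koszulD_koszulInl _ _)
  have hbot : quotPart (⊥ : Ideal (MvPolynomial (Fin n) K)) (0 - 1) = ⊥ := by
    rw [quotPart, freePart_of_neg _ (by omega), AddSubgroup.map_bot]
  rw [koszulPart_of_eq_bot hbot _ _ b hb, map_zero] at e
  have h2 := koszulInl_injective _ (e.symm.trans (map_zero _).symm)
  exact one_ne_zero ((Submodule.Quotient.mk_eq_zero _).1 h2)

/-- Ideals generated by squarefree monomials with disjoint supports: the top Koszul homology. -/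
theorem disjoint_supports_regularity (B : ℕ → Finset (Fin n)) (s : Finset ℕ)
    (hne : ∀ i ∈ s, (B i).Nonempty) (hd : ∀ i ∈ s, ∀ j ∈ s, i ≠ j → Disjoint (B i) (B j)) :
    RegularityLE (squarefreeIdeal K (B '' (s : Set ℕ))) (∑ i ∈ s, ((B i).card : ℤ) - s.card) ∧
      ¬ KoszulVanishes (quotPart (squarefreeIdeal K (B '' (s : Set ℕ)))) (polyVariables K n)
        s.card (∑ i ∈ s, ((B i).card : ℤ) - s.card) := by
  induction s using Finset.induction_on with
  | empty =>
    have : squarefreeIdeal K (B '' ((∅ : Finset ℕ) : Set ℕ)) = ⊥ := by simp [squarefreeIdeal]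
    rw [this]
    simpa using And.intro regularityLE_bot not_koszulVanishes_bot
  | insert k s hk ih =>
    obtain ⟨h1, h2⟩ := ih (fun i hi => hne i (Finset.mem_insert_of_mem hi)) fun i hi j hj =>
      hd i (Finset.mem_insert_of_mem hi) j (Finset.mem_insert_of_mem hj)
    have hkne := hne k (Finset.mem_insert_self k s)
    have hpos := hkne.card_pos
    have hdis : ∀ A ∈ B '' (s : Set ℕ), Disjoint A (B k) := by
      rintro _ ⟨i, hi, rfl⟩
      refine hd i (Finset.mem_insert_of_mem hi) k (Finset.mem_insert_self k s) ?_
      rintro rfl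
      exact hk hi
    rw [Finset.coe_insert, Set.image_insert_eq, Finset.sum_insert hk, Finset.card_insert_of_notMem hk]
    -- The new monomial `u` satisfies `I : u = I`. The homology of `S/I` vanishes at the coefficient
    -- degree reached here, by `h1`, so the top homology of `S/(I, u)` maps onto that of `S/I(-|B
    -- k|)`; vanishing of the former would contradict `h2`.
    refine ⟨(h1.insert hdis hkne).mono (by push_cast; omega), fun h => h2 ?_⟩
    have h3 := (gradedShortExact_colon (K := K) (B '' (s : Set ℕ)) (B k)).vanishes_left (raisesDegree_quotPart _) (i := s.card)
      (p := (B k).card + ∑ i ∈ s, ((B i).card : ℤ) - s.card) (h1 _ _ (by omega))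
      (by
        rw [Nat.cast_succ] at h
        convert h using 1
        ring)
    rw [koszulVanishes_shift, image_sdiff_eq_self hdis] at h3
    convert h3 using 1
    ring

theorem isTSpreadMonomial_iff {t : ℕ} {u : MvPolynomial (Fin n) K} :
    IsTSpreadMonomial t u ↔ ∃ l : List (Fin n),
      l.Pairwise (fun a b : Fin n => (a : ℕ) + t ≤ (b : ℕ)) ∧ u = (l.map X).prod := by
  have : IsTrans ℕ fun a b => a + t ≤ b := ⟨fun a b c h h' => by omega⟩
  refine exists_congr fun l => and_congr_left fun _ => ?_
  rw [List.isChain_iff_pairwise, ← List.pairwise_map (f := fun a : Fin n => (a : ℕ))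
    (R := fun a b => a + t ≤ b)]
  -- In `IsTSpreadMonomial` the chain relation lives on `ℕ`, so the list of `Fin n` is coerced
  -- monadically to a list of naturals.
  have e : (l >>= fun a => pure (a : ℕ)) = l.map fun a : Fin n => (a : ℕ) := by
    rw [List.bind_eq_flatMap]
    exact List.flatMap_pure_eq_map _ l
  exact iff_of_eq (congrArg _ e)

theorem IsTSpreadMonomial.exists_finset {t : ℕ} (ht : 1 ≤ t) {u : MvPolynomial (Fin n) K}
    (h : IsTSpreadMonomial t u) :
    ∃ A : Finset (Fin n), (∀ a ∈ A, ∀ b ∈ A, a ≠ b → (a : ℕ) + t ≤ b ∨ (b : ℕ) + t ≤ a) ∧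
      u = ∏ i ∈ A, X i := by
  obtain ⟨l, hp, rfl⟩ := isTSpreadMonomial_iff.1 h
  have hnd : l.Nodup := hp.imp fun {a b} hab e => by
    subst e
    omega
  refine ⟨l.toFinset, fun a ha b hb hab => ?_, (List.prod_toFinset _ hnd).symm⟩
  have hp' : l.Pairwise fun a b : Fin n => (a : ℕ) + t ≤ b ∨ (b : ℕ) + t ≤ a := hp.imp Or.inl
  have : Std.Symm fun a b : Fin n => (a : ℕ) + t ≤ b ∨ (b : ℕ) + t ≤ a := ⟨fun _ _ h => Or.symm h⟩
  exact hp'.forall (List.mem_toFinset.1 ha) (List.mem_toFinset.1 hb) hab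

/-- The `t`-spread generators and the generators of degree at most `d` may be different sets. Each
term of a generator of the second kind is divisible by some `t`-spread generator, necessarily of
degree at most `d`, so those alone generate. -/
theorem IsTSpreadIdeal.exists_eq_squarefreeIdeal {t d : ℕ} (ht : 1 ≤ t)
    {I : Ideal (MvPolynomial (Fin n) K)} (h : IsTSpreadIdeal t I) (hd : IsGeneratedInDegreesLE d I) :
    ∃ 𝓕 : Set (Finset (Fin n)), I = squarefreeIdeal K 𝓕 ∧ ∀ A ∈ 𝓕, A.card ≤ d ∧
      ∀ a ∈ A, ∀ b ∈ A, a ≠ b → (a : ℕ) + t ≤ b ∨ (b : ℕ) + t ≤ a := by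
  obtain ⟨U, hU, rfl⟩ := h
  obtain ⟨G, hG, e⟩ := hd
  let 𝓕 : Set (Finset (Fin n)) := {A | (∏ i ∈ A, X i : MvPolynomial (Fin n) K) ∈ U ∧
    ∀ a ∈ A, ∀ b ∈ A, a ≠ b → (a : ℕ) + t ≤ b ∨ (b : ℕ) + t ≤ a}
  have h𝓕 : Ideal.span U = squarefreeIdeal K 𝓕 := by
    apply le_antisymm
    · refine Ideal.span_le.2 fun u hu => ?_
      obtain ⟨A, hA, rfl⟩ := (hU u hu).exists_finset ht
      exact Ideal.subset_span ⟨A, ⟨hu, hA⟩, rfl⟩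
    · refine Ideal.span_le.2 ?_
      rintro _ ⟨A, hA, rfl⟩
      exact Ideal.subset_span hA.1
  refine ⟨{A ∈ 𝓕 | A.card ≤ d}, le_antisymm ?_ ?_, fun A hA => ⟨hA.2, hA.1.2⟩⟩
  · rw [e, Ideal.span_le]
    intro g hg
    obtain ⟨c, hc, hgc⟩ := hG g hg
    have hgI : g ∈ squarefreeIdeal K 𝓕 := by
      rw [← h𝓕, e]
      exact Ideal.subset_span hg
    refine mem_squarefreeIdeal.2 fun m hm => ?_
    obtain ⟨A, hA, hAm⟩ := mem_squarefreeIdeal.1 hgI m hm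
    refine ⟨A, ⟨hA, ?_⟩, hAm⟩
    have h1 := hgc (mem_support_iff.1 hm)
    have h2 : m.degree = c := by
      rw [Finsupp.degree_eq_weight_one]
      exact h1
    rw [← degree_squarefreeExponent]
    exact (Finsupp.degree_mono (squarefreeExponent_le_iff.2 hAm)).trans (h2.trans_le hc)
  · rw [h𝓕]
    exact squarefreeIdeal_mono fun A hA => hA.1

theorem card_window {t : ℕ} (htn : t ≤ n) :
    (Finset.univ.filter fun i : Fin n => (i : ℕ) < t).card = t := by
  rw [Fin.card_filter_val_lt, min_eq_right htn]

theorem regularityLE_of_isTSpreadIdeal {t d : ℕ} (ht : 1 ≤ t) (hd : 1 ≤ d) (htn : t ≤ n)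
    {I : Ideal (MvPolynomial (Fin n) K)} (h : IsTSpreadIdeal t I) (h' : IsGeneratedInDegreesLE d I)
    {m : ℕ} (hm : m = max ⌈(n : ℚ) / (d : ℚ)⌉₊ t) : RegularityLE I ((n : ℤ) - m) := by
  obtain ⟨𝓕, rfl, h𝓕⟩ := h.exists_eq_squarefreeIdeal ht h'
  have hred : IsReducedTo 𝓕 Finset.univ := fun A _ => Or.inl (Finset.subset_univ A)
  have hcard : (Finset.univ : Finset (Fin n)).card = n := by simp
  rcases max_choice ⌈(n : ℚ) / (d : ℚ)⌉₊ t with hmax | hmax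
  · refine regularityLE_of_degree_le d 𝓕 Finset.univ hred hd (fun A hA _ => (h𝓕 A hA).1) _ ?_
    rw [hcard]
    have hm' : m = ⌈(n : ℚ) / (d : ℚ)⌉₊ := hm.trans hmax
    have h1 : ¬ (n : ℚ) / d ≤ ((m - 1 : ℕ) : ℚ) := by
      rw [← Nat.ceil_le]
      have : 1 ≤ m := by omega
      omega
    rw [div_le_iff₀ (by exact_mod_cast hd)] at h1
    have h2 : (m - 1) * d < n := by
      by_contra! h2
      exact h1 (by exact_mod_cast h2)
    have h3 : ((m - 1 : ℕ) : ℤ) = m - 1 := by omega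
    have h4 : (((m - 1) * d : ℕ) : ℤ) < n := by exact_mod_cast h2
    rw [Nat.cast_mul, h3] at h4
    calc (d : ℤ) * (n - (n - m) - 1) = (m - 1) * d := by ring
      _ < n := h4
  -- Two distinct indices in a `t`-spread monomial differ by at least `t`, so at most one is among
  -- the first `t`.
  · have hw := regularityLE_of_card_inter_le_one (K := K)
      (Finset.univ.filter fun i : Fin n => (i : ℕ) < t) 𝓕 Finset.univ hred (Finset.subset_univ _)
      fun A hA _ => ?_
    · rw [hcard, card_window htn] at hw
      rwa [hm, hmax]
    · refine Finset.card_le_one.2 fun a ha b hb => ?_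
      simp only [Finset.mem_inter, Finset.mem_filter, Finset.mem_univ, true_and] at ha hb
      by_contra hab
      have := (h𝓕 A hA).2 a ha.1 b hb.1 hab
      omega

/-- The support of a generator of a Pascal ideal. -/
def pascalSupport (n m i : ℕ) : Finset (Fin n) :=
  Finset.univ.filter fun j : Fin n => (j : ℕ) + 1 ≡ i [MOD m]

theorem mem_pascalSupport {m i : ℕ} {j : Fin n} :
    j ∈ pascalSupport n m i ↔ (j : ℕ) + 1 ≡ i [MOD m] := by
  simp [pascalSupport]

theorem pascalMonomial_eq (m i : ℕ) :
    pascalMonomial K n m i = ∏ j ∈ pascalSupport n m i, X j := rfl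

theorem pascalIdeal_eq (m : ℕ) : pascalIdeal K n m =
    squarefreeIdeal K (pascalSupport n m '' (Finset.Icc 1 m : Set ℕ)) := by
  rw [squarefreeIdeal, Set.image_image, Finset.coe_Icc]
  rfl

theorem vars_pascalMonomial (m i : ℕ) : (pascalMonomial K n m i).vars = pascalSupport n m i := by
  rw [pascalMonomial_eq, ← monomial_squarefreeExponent, vars_monomial one_ne_zero]
  simpa using support_squarefreeExponent_add (pascalSupport n m i) 0

theorem eq_of_modEq_of_mem_Icc {m i j : ℕ} (hi : i ∈ Set.Icc 1 m) (hj : j ∈ Set.Icc 1 m)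
    (h : i ≡ j [MOD m]) : i = j := by
  obtain ⟨hi1, hi2⟩ := hi
  obtain ⟨hj1, hj2⟩ := hj
  have h' : i - 1 ≡ j - 1 [MOD m] := by
    apply Nat.ModEq.add_right_cancel' 1
    rwa [Nat.sub_add_cancel hi1, Nat.sub_add_cancel hj1]
  have := h'.eq_of_lt_of_lt (by omega) (by omega)
  omega

theorem disjoint_pascalSupport {m i j : ℕ} (hi : i ∈ Set.Icc 1 m) (hj : j ∈ Set.Icc 1 m)
    (hij : i ≠ j) : Disjoint (pascalSupport n m i) (pascalSupport n m j) := by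
  refine Finset.disjoint_left.2 fun k hk hk' => hij ?_
  exact eq_of_modEq_of_mem_Icc hi hj
    ((mem_pascalSupport.1 hk).symm.trans (mem_pascalSupport.1 hk'))

theorem pascalSupport_nonempty {m i : ℕ} (hmn : m ≤ n) (hi : i ∈ Set.Icc 1 m) :
    (pascalSupport n m i).Nonempty := by
  obtain ⟨h1, h2⟩ := hi
  refine ⟨⟨i - 1, by omega⟩, mem_pascalSupport.2 ?_⟩
  rw [Nat.sub_add_cancel h1]

theorem sum_card_pascalSupport {m : ℕ} (hm : 1 ≤ m) :
    ∑ i ∈ Finset.Icc 1 m, (pascalSupport n m i).card = n := by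
  have hdis : ((Finset.Icc 1 m : Finset ℕ) : Set ℕ).PairwiseDisjoint (pascalSupport n m) :=
    fun i hi j hj hij => disjoint_pascalSupport (by simpa using hi) (by simpa using hj) hij
  rw [← Finset.card_biUnion hdis]
  have : (Finset.Icc 1 m).biUnion (pascalSupport n m) = Finset.univ := by
    refine Finset.eq_univ_of_forall fun j => Finset.mem_biUnion.2 ⟨(j : ℕ) % m + 1, ?_, ?_⟩
    · have := Nat.mod_lt (j : ℕ) hm
      exact Finset.mem_Icc.2 ⟨by omega, by omega⟩
    · exact mem_pascalSupport.2 ((Nat.mod_modEq _ _).symm.add_right 1)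
  rw [this, Finset.card_univ, Fintype.card_fin]

theorem card_pascalSupport_le {m d i : ℕ} (h : n ≤ m * d) : (pascalSupport n m i).card ≤ d := by
  rw [← Finset.card_range d]
  refine Finset.card_le_card_of_injOn (fun j => (j : ℕ) / m) (fun j _ => ?_) fun j hj k hk e => ?_
  · exact Finset.mem_coe.2 (Finset.mem_range.2 (Nat.div_lt_of_lt_mul (j.2.trans_le h)))
  · have h1 : (j : ℕ) ≡ k [MOD m] := Nat.ModEq.add_right_cancel' 1
      ((mem_pascalSupport.1 hj).trans (mem_pascalSupport.1 hk).symm)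
    have h2 : (j : ℕ) / m = (k : ℕ) / m := e
    refine Fin.ext ?_
    rw [← Nat.div_add_mod (j : ℕ) m, ← Nat.div_add_mod (k : ℕ) m, h2, h1]

theorem isTSpreadMonomial_pascalMonomial {t m : ℕ} (h : t ≤ m) (i : ℕ) :
    IsTSpreadMonomial t (pascalMonomial K n m i) := by
  refine isTSpreadMonomial_iff.2 ⟨(pascalSupport n m i).sort (· ≤ ·), ?_, ?_⟩
  · refine ((Finset.sortedLT_sort (pascalSupport n m i)).pairwise.imp_of_mem ?_)
    intro a b ha hb hab
    rw [Finset.mem_sort, mem_pascalSupport] at ha hb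
    have h1 : (a : ℕ) ≡ b [MOD m] := Nat.ModEq.add_right_cancel' 1 (ha.trans hb.symm)
    have h2 : (a : ℕ) < b := hab
    have h3 := Nat.le_of_dvd (by omega) ((Nat.modEq_iff_dvd' h2.le).1 h1)
    omega
  · rw [← List.prod_toFinset _ (Finset.sort_nodup _ _), Finset.sort_toFinset]
    rfl

theorem regularity_pascalIdeal {m : ℕ} (hm : 1 ≤ m) (hmn : m ≤ n) :
    regularity (pascalIdeal K n m) = (((n : ℤ) + 1 - (m : ℤ) : ℤ) : WithTop ℤ) := by
  obtain ⟨h1, h2⟩ := disjoint_supports_regularity (K := K) (pascalSupport n m) (Finset.Icc 1 m)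
    (fun i hi => pascalSupport_nonempty hmn (by simpa using hi))
    (fun i hi j hj => disjoint_pascalSupport (by simpa using hi) (by simpa using hj))
  have hsum : ∑ i ∈ Finset.Icc 1 m, ((pascalSupport n m i).card : ℤ) = n := by
    exact_mod_cast sum_card_pascalSupport hm
  rw [← pascalIdeal_eq, hsum, Nat.card_Icc, Nat.add_sub_cancel] at h1 h2
  have e1 : (n : ℤ) - m + 1 = n + 1 - m := by ring
  refine le_antisymm ?_ ?_
  · rw [← e1]
    exact regularity_le (by omega) h1
  · have hres : Nonempty (MinimalGradedFreeResolution (pascalIdeal K n m)) := by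
      refine nonempty_minimalGradedFreeResolution _ ?_
      rw [pascalIdeal_eq]
      exact isGradedSubmodule_squarefreeIdeal _
    have e2 : ((m - 1 : ℕ) : ℤ) = m - 1 := by omega
    have e3 : (n : ℤ) - (m - 1) = n + 1 - m := by ring
    have e4 : (n : ℤ) + 1 - m - 1 = n - m := by ring
    -- The last Betti number of the `m`-generated complete intersection: `H_m(S/J)` corresponds to
    -- homological degree `m - 1` for `J`, in internal degree `n`.
    have h3 := le_regularity hres (i := m - 1) (j := n) (by omega)
      (by rwa [e2, sub_add_cancel, e3, e4])
    rwa [e2, e3] at h3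

end Bounds

end TSpread

end

theorem mainTheorem3 {K : Type*} [Field K] (n d t : ℕ) (hn : 1 ≤ n) (hd : 1 ≤ d) (ht : 1 ≤ t)
    (htn : t ≤ n) (hnd : 1 + (d - 1) * t ≤ n)
    (m : ℕ) (hm : m = max ⌈(n : ℚ) / (d : ℚ)⌉₊ t) :
    -- the upper bound `reg(I) ≤ n + 1 - m`
    (∀ I : Ideal (MvPolynomial (Fin n) K),
      TSpread.IsTSpreadIdeal t I → TSpread.IsGeneratedInDegreesLE d I →
        TSpread.regularity I ≤ (((n : ℤ) + 1 - (m : ℤ) : ℤ) : WithTop ℤ)) ∧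
    -- it is attained by the Pascal ideal of type `(n, m)`
    m ≤ n ∧
    (∀ i ∈ Set.Icc 1 m, ∀ j ∈ Set.Icc 1 m, i ≠ j →
      Disjoint (TSpread.pascalMonomial K n m i).vars (TSpread.pascalMonomial K n m j).vars) ∧
    TSpread.IsTSpreadIdeal t (TSpread.pascalIdeal K n m) ∧
    TSpread.IsGeneratedInDegreesLE d (TSpread.pascalIdeal K n m) ∧
    TSpread.regularity (TSpread.pascalIdeal K n m) =
      (((n : ℤ) + 1 - (m : ℤ) : ℤ) : WithTop ℤ) := by
  have hmn : m ≤ n := by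
    rw [hm]
    refine max_le (Nat.ceil_le.2 ?_) htn
    exact div_le_self (Nat.cast_nonneg n) (by exact_mod_cast hd)
  have htm : t ≤ m := hm ▸ le_max_right _ _
  have hnm : n ≤ m * d := by
    have h1 : (n : ℚ) / d ≤ m := (Nat.le_ceil _).trans (by
      rw [hm]
      exact_mod_cast le_max_left _ _)
    rw [div_le_iff₀ (by exact_mod_cast hd)] at h1
    exact_mod_cast h1
  refine ⟨fun I hI hI' => ?_, hmn, fun i hi j hj hij => ?_, ?_, ?_, ?_⟩
  · have h := TSpread.regularity_le (by omega)
      (TSpread.regularityLE_of_isTSpreadIdeal ht hd htn hI hI' hm)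
    rwa [sub_add_eq_add_sub] at h
  · rw [TSpread.vars_pascalMonomial, TSpread.vars_pascalMonomial]
    exact TSpread.disjoint_pascalSupport hi hj hij
  · refine ⟨_, ?_, rfl⟩
    rintro _ ⟨i, -, rfl⟩
    exact TSpread.isTSpreadMonomial_pascalMonomial htm i
  · refine ⟨_, ?_, rfl⟩
    rintro _ ⟨i, -, rfl⟩
    refine ⟨_, TSpread.card_pascalSupport_le (i := i) hnm, ?_⟩
    rw [TSpread.pascalMonomial_eq, ← TSpread.monomial_squarefreeExponent]
    exact isHomogeneous_monomial _ (TSpread.degree_squarefreeExponent _)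
  · exact TSpread.regularity_pascalIdeal (ht.trans htm) hmn
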